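/- Let $k\ge 3$ and $m>5$ be integers. All hypergraphs are finite, and the vertex and edge sets of a hypergraph $G$ are denoted $V(G)$ and $E(G)$. A hypergraph is $k$-uniform if all its edges have exactly $k$ vertices. For a $k$-uniform hypergraph $G$ on $n$ vertices let $\mathcal A(G)$ be its adjacency tensor, that is, the order-$k$ tensor indexed by the vertices whose entry at $(i_1,\dots,i_k)$ is $\frac1{(k-1)!}$ if $\{i_1,\dots,i_k\}\in E(G)$ and $0$ otherwise. A number $\lambda\in\mathbb C$ is an eigenvalue of $\mathcal A(G)$ if there is a nonzero $x\in\mathbb C^n$ with $\sum_{i_2,\dots,i_k}\mathcal A(G)_{i i_2\cdots i_k}x_{i_2}\cdots x_{i_k}=\lambda x_i^{k-1}$ for all $i$, and the spectral radius $\rho(G)$ is the maximum modulus of an eigenvalue of $\mathcal A(G)$. The $k$-th power $\Gamma^k$ of a simple graph $\Gamma$ is the $k$-uniform hypergraph obtained by adding to each edge of $\Gamma$ its own $k-2$ new vertices; a $k$-uniform hypergraph is a power hypergraph if it is isomorphic to the $k$-th power of a simple graph. A $k$-uniform hypergraph is bicyclic if it is connected and $|E(G)|(k-1)-|V(G)|+1=2$.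 Let $G_{10}$ be the $k$-th power of the graph consisting of two triangles that share an edge, and let the hyperstar with $r$ edges be the $k$-th power of the star $K_{1,r}$, its center being the center of $K_{1,r}$. Let $B_m^P$ be the hypergraph obtained from $G_{10}$ by attaching a hyperstar with $m-5$ edges at a vertex $v$ of degree $3$ of $G_{10}$, that is, by taking disjoint copies of the two hypergraphs and identifying the center of the hyperstar with $v$. Then $G_{10}$ has a vertex of degree $3$ and, for every choice of the vertex $v$ of degree $3$, $B_m^P$ is, up to isomorphism, the unique hypergraph with maximum spectral radius among all power bicyclic $k$-uniform hypergraphs with $m$ edges: it is itself such a hypergraph, and every power bicyclic $k$-uniform hypergraph $G$ with $m$ edges satisfies $\rho(G)\le\rho(B_m^P)$, with equality if and only if $G$ is isomorphic to $B_m^P$. -/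

import Mathlib

open scoped Hypergraph

noncomputable section

/-! ### Tensors, eigenvalues and the spectral radius -/

namespace HypTensor

variable {ι : Type*} [Fintype ι]

/-- For a real tensor `T` of order `d + 1` with index set `ι` and a complex vector `x`, this is the
vector `T x ^ d`, i.e. `(T x ^ d) i = ∑ T (i, i₂, …, i_{d+1}) * x i₂ * ⋯ * x i_{d+1}`, the sum being
over all `i₂, …, i_{d+1}`. -/
def mulVec {d : ℕ} (T : (Fin (d + 1) → ι) → ℝ) (x : ι → ℂ) (i : ι) : ℂ :=
  ∑ f : Fin d → ι, (T (Fin.cons i f) : ℂ) * ∏ j, x (f j)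

/-- `μ` is an eigenvalue of the tensor `T` of order `d + 1`: the system `T x ^ d = μ x ^ [d]`
has a nonzero complex solution `x`. -/
def IsEigenvalue {d : ℕ} (T : (Fin (d + 1) → ι) → ℝ) (μ : ℂ) : Prop :=
  ∃ x : ι → ℂ, x ≠ 0 ∧ ∀ i, mulVec T x i = μ * x i ^ d

/-- The spectral radius of a tensor: the largest modulus of an eigenvalue. -/
def spectralRadius {d : ℕ} (T : (Fin (d + 1) → ι) → ℝ) : ℝ :=
  sSup {r : ℝ | ∃ μ : ℂ, IsEigenvalue T μ ∧ ‖μ‖ = r}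

theorem norm_le_of_isEigenvalue {d : ℕ} (T : (Fin (d + 1) → ι) → ℝ) {μ : ℂ}
    (h : IsEigenvalue T μ) : ‖μ‖ ≤ ∑ g, |T g| := by
  obtain ⟨x, hx, h⟩ := h
  obtain ⟨a, ha⟩ := Function.ne_iff.mp hx
  have : Nonempty ι := ⟨a⟩
  obtain ⟨i, hi⟩ := Finite.exists_max fun i => ‖x i‖
  have hpos : 0 < ‖x i‖ := lt_of_lt_of_le (norm_pos_iff.mpr ha) (hi a)
  have h1 : ‖μ‖ * ‖x i‖ ^ d ≤ (∑ g, |T g|) * ‖x i‖ ^ d := by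
    calc ‖μ‖ * ‖x i‖ ^ d = ‖mulVec T x i‖ := by rw [h i, norm_mul, norm_pow]
      _ ≤ ∑ f : Fin d → ι, |T (Fin.cons i f)| * ‖x i‖ ^ d := by
          refine (norm_sum_le _ _).trans (Finset.sum_le_sum fun f _ => ?_)
          rw [norm_mul, norm_prod, Complex.norm_real, Real.norm_eq_abs]
          refine mul_le_mul_of_nonneg_left ?_ (abs_nonneg _)
          refine (Finset.prod_le_prod (fun j _ => norm_nonneg _) fun j _ => hi (f j)).trans ?_
          simp
      _ = (∑ f : Fin d → ι, |T (Fin.cons i f)|) * ‖x i‖ ^ d := by rw [Finset.sum_mul]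
      _ ≤ _ := by
          refine mul_le_mul_of_nonneg_right ?_ (by positivity)
          have hinj : Function.Injective fun f : Fin d → ι =>
              (Fin.cons i f : Fin (d + 1) → ι) := by
            intro f f' hf
            exact Fin.cons_right_injective (α := fun _ => ι) i hf
          have := Finset.sum_le_univ_sum_of_nonneg (f := fun g => |T g|)
            (s := Finset.univ.map ⟨_, hinj⟩) (fun g => abs_nonneg _)
          simpa using this
  exact le_of_mul_le_mul_right h1 (by positivity)

/-- A tensor with an eigenvalue has an eigenvalue of largest modulus, so that the supremum in the
definition of the spectral radius is a maximum. -/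
theorem isGreatest_spectralRadius {d : ℕ} (T : (Fin (d + 1) → ι) → ℝ)
    (hT : ∃ μ : ℂ, IsEigenvalue T μ) :
    IsGreatest {r : ℝ | ∃ μ : ℂ, IsEigenvalue T μ ∧ ‖μ‖ = r} (spectralRadius T) := by
  set K : Set (ℂ × (ι → ℂ)) :=
    (Metric.closedBall 0 (∑ g, |T g|) ×ˢ Metric.sphere 0 1) ∩
      {p | ∀ i, mulVec T p.2 i = p.1 * p.2 i ^ d} with hK
  have hcomp : IsCompact K := by
    refine ((isCompact_closedBall _ _).prod (isCompact_sphere _ _)).inter_right ?_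
    simp only [Set.ofPred_forall]
    refine isClosed_iInter fun i => isClosed_eq ?_ ?_
    · unfold mulVec; fun_prop
    · fun_prop
  have hS : {r : ℝ | ∃ μ : ℂ, IsEigenvalue T μ ∧ ‖μ‖ = r} = (fun p => ‖p.1‖) '' K := by
    ext r
    constructor
    · rintro ⟨μ, hμ, rfl⟩
      have hb := norm_le_of_isEigenvalue T hμ
      obtain ⟨x, hx, h⟩ := hμ
      have hn : ‖x‖ ≠ 0 := norm_ne_zero_iff.mpr hx
      refine ⟨(μ, ((‖x‖ : ℂ)⁻¹) • x), ⟨⟨by simpa using hb, ?_⟩, fun i => ?_⟩, rfl⟩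
      · simp [norm_smul, hn]
      · have : mulVec T ((‖x‖ : ℂ)⁻¹ • x) i = ((‖x‖ : ℂ)⁻¹) ^ d * mulVec T x i := by
          simp only [mulVec, Pi.smul_apply, smul_eq_mul, Finset.prod_mul_distrib, Finset.mul_sum]
          refine Finset.sum_congr rfl fun f _ => ?_
          simp
          ring
        simp only [this, h i, Pi.smul_apply, smul_eq_mul, mul_pow]
        ring
    · rintro ⟨⟨μ, x⟩, ⟨⟨-, hx⟩, h⟩, rfl⟩
      refine ⟨μ, ⟨x, ?_, h⟩, rfl⟩
      rintro rfl
      simp at hx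
  have hne : {r : ℝ | ∃ μ : ℂ, IsEigenvalue T μ ∧ ‖μ‖ = r}.Nonempty := by
    obtain ⟨μ, hμ⟩ := hT
    exact ⟨_, μ, hμ, rfl⟩
  have hc : IsCompact {r : ℝ | ∃ μ : ℂ, IsEigenvalue T μ ∧ ‖μ‖ = r} := by
    rw [hS]; exact hcomp.image (by fun_prop)
  exact hc.isGreatest_sSup hne

end HypTensor

/-! ### Hypergraphs -/

namespace Hypergraph

variable {α β : Type*}

/-- Every edge has exactly `k` vertices (used for `k ≥ 3`). -/
def IsUniform (H : Hypergraph α) (k : ℕ) : Prop :=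
  ∀ e ∈ E(H), e.ncard = k

/-- The degree of a vertex: the number of edges containing it. -/
def degree (H : Hypergraph α) (v : α) : ℕ :=
  {e | e ∈ E(H) ∧ v ∈ e}.ncard

/-- Two vertices are related if there is a walk between them. -/
def reachableSetoid (H : Hypergraph α) : Setoid V(H) where
  r x y := Relation.ReflTransGen H.Adj (x : α) (y : α)
  iseqv :=
    { refl := fun _ => .refl
      symm := fun h => by
        have : Std.Symm H.Adj := ⟨fun _ _ h => h.symm⟩
        exact Relation.ReflTransGen.stdSymm.symm _ _ h
      trans := fun h₁ h₂ => h₁.trans h₂ }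

/-- A hypergraph is connected if it has a vertex and any two vertices are joined by a walk. -/
def IsConnected (H : Hypergraph α) : Prop :=
  V(H).Nonempty ∧ ∀ x ∈ V(H), ∀ y ∈ V(H), Relation.ReflTransGen H.Adj x y

/-- The number of connected components. -/
def numComponents (H : Hypergraph α) : ℕ :=
  Nat.card (Quotient H.reachableSetoid)

/-- The cyclomatic number `c(H) = m (k - 1) - n + l` of a `k`-uniform hypergraph with `n` vertices,
`m` edges and `l` connected components. -/
def cyclomaticNumber (H : Hypergraph α) (k : ℕ) : ℤ :=
  (E(H).ncard : ℤ) * ((k : ℤ) - 1) - (V(H).ncard : ℤ) + (H.numComponents : ℤ)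

/-- A `k`-uniform hypergraph is bicyclic if it is connected with cyclomatic number `2`. -/
def IsBicyclic (H : Hypergraph α) (k : ℕ) : Prop :=
  H.IsConnected ∧ H.cyclomaticNumber k = 2

/-- The adjacency tensor, of order `(k - 1) + 1 = k` and indexed by the vertices, of a `k`-uniform
hypergraph. -/
def adjacencyTensor (H : Hypergraph α) (k : ℕ) : (Fin (k - 1 + 1) → V(H)) → ℝ :=
  open Classical in
  fun g => if Set.range (fun j => (g j : α)) ∈ E(H) then 1 / (Nat.factorial (k - 1) : ℝ) else 0

/-- The spectral radius of a finite `k`-uniform hypergraph, i.e. of its adjacency tensor. -/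
def spectralRadius (H : Hypergraph α) (k : ℕ) [Finite V(H)] : ℝ :=
  letI : Fintype V(H) := Fintype.ofFinite V(H)
  HypTensor.spectralRadius (H.adjacencyTensor k)

/-- Two hypergraphs are isomorphic: there is a bijection between the vertex sets which preserves
edges in both directions. -/
def Isomorphic (H : Hypergraph α) (H' : Hypergraph β) : Prop :=
  ∃ f : V(H) ≃ V(H'), ∀ s : Set V(H),
    (Subtype.val '' s ∈ E(H) ↔ Subtype.val '' (f '' s) ∈ E(H'))

/-- The `k`-th power of a simple graph: every edge is enlarged by `k - 2` new vertices of its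
own. -/
def power {W : Type*} (G : SimpleGraph W) (k : ℕ) :
    Hypergraph (W ⊕ (G.edgeSet × Fin (k - 2))) where
  vertexSet := Set.univ
  edgeSet := Set.range fun e : G.edgeSet =>
    Sum.inl '' {w : W | w ∈ (e : Sym2 W)} ∪ Sum.inr '' {p : G.edgeSet × Fin (k - 2) | p.1 = e}
  subset_vertexSet_of_mem_edgeSet' := fun _ _ => Set.subset_univ _

/-- `H` is (up to isomorphism) the `k`-th power of a simple graph. -/
def IsPower.{u} {α : Type u} (H : Hypergraph α) (k : ℕ) : Prop :=
  ∃ (W : Type u) (G : SimpleGraph W), H.Isomorphic (power G k)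

/-- The hypergraph obtained from disjoint copies of `H₁` and `H₂` by identifying the vertex `v` of
`H₁` with the vertex `u` of `H₂` (that is, by attaching `H₂` with its vertex `u` at `v`). -/
def coalescence (H₁ : Hypergraph α) (v : α) (H₂ : Hypergraph β) (u : β) : Hypergraph (α ⊕ β) :=
  open Classical in
  let ι₁ : α → α ⊕ β := Sum.inl
  let ι₂ : β → α ⊕ β := fun w => if w = u then Sum.inl v else Sum.inr w
  { vertexSet := V(H₁.image ι₁) ∪ V(H₂.image ι₂)
    edgeSet := E(H₁.image ι₁) ∪ E(H₂.image ι₂)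
    subset_vertexSet_of_mem_edgeSet' := by
      rintro e (he | he)
      · exact (subset_vertexSet_of_mem_edgeSet he).trans Set.subset_union_left
      · exact (subset_vertexSet_of_mem_edgeSet he).trans Set.subset_union_right }

/-- The class of finite power bicyclic `k`-uniform hypergraphs with `m` edges. -/
structure IsPowerBicyclic {α : Type*} (H : Hypergraph α) (k m : ℕ) : Prop where
  finite : V(H).Finite
  uniform : H.IsUniform k
  power : H.IsPower k
  bicyclic : H.IsBicyclic k
  card_edges : E(H).ncard = m

/-- The theta graph made of the two triangles `{0, 1, 2}` and `{0, 1, 3}`, which share the edge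
`{0, 1}`. -/
def thetaGraph : SimpleGraph (Fin 4) :=
  SimpleGraph.fromEdgeSet {s(0, 1), s(0, 2), s(1, 2), s(0, 3), s(1, 3)}

/-- The hypergraph `G₁₀`: the `k`-th power of the theta graph. -/
def thetaPower (k : ℕ) : Hypergraph (Fin 4 ⊕ (thetaGraph.edgeSet × Fin (k - 2))) :=
  power thetaGraph k

/-- The `k`-uniform hyperstar with `r` edges: the `k`-th power of the star `K_{1,r}`. The star has
vertices `0, …, r` and center `0`, so the center of the hyperstar is `Sum.inl 0`. -/
def hyperstar (k r : ℕ) :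
    Hypergraph (Fin (r + 1) ⊕
      ((SimpleGraph.starGraph (0 : Fin (r + 1))).edgeSet × Fin (k - 2))) :=
  power (SimpleGraph.starGraph (0 : Fin (r + 1))) k

/-- The hypergraph obtained from `G₁₀` by attaching the hyperstar with `m - 5` edges, by its center,
at the vertex `v` of `G₁₀`. -/
def thetaPowerWithStar (k m : ℕ) (v : Fin 4 ⊕ (thetaGraph.edgeSet × Fin (k - 2))) :=
  coalescence (thetaPower k) v (hyperstar k (m - 5)) (Sum.inl 0)

end Hypergraph

end

/-! The problem is moved from hypergraphs to graphs. For an edge of `power G k`, let M be the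
product of an eigenvector over its `k` vertices. Multiplying the eigenvalue equation at a vertex `a`
by `x a` shows that the M of the edges at `a` add up to `μ * x a ^ k`; at a vertex lying in one edge
only, this gives that vertex's value in terms of M. Eliminating these vertices leaves the graph,
with `√(‖μ‖ ^ k)` in the role of the eigenvalue and `√(‖x a‖ ^ k)` as entries. Only two inequalities
are needed, so no Perron–Frobenius theory is used: an eigenvector of the power gives a nonnegative
sub-eigenvector of the graph (`exists_subeigenvector`), and a positive eigenvector of the graph
lifts to the power (`exists_eigenvector_power`).

A power hypergraph is bicyclic exactly when its graph is connected with one more edge than its n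
vertices, so n = m - 1 ≥ 5. It remains to show that among such graphs the book, a star plus two
edges sharing a vertex, has the largest eigenvalue. For the book it is the root of l ^ 2 = n - 1 +
(4l + 6) / (l ^ 2 - 2), and the difference of the two sides increases with l.

For a competitor, scale a sub-eigenvector to have maximum 1 at a vertex u, and take a breadth-first
tree at u. All neighbours of u are its children, so the two edges outside the tree avoid u. Applying
the inequality at u and then at its children bounds l ^ 2 by the degree of u, plus the weight A of
the grandchildren, plus what the two extra edges bring to the children (`sq_le`). With s vertices
other than u and its children, the degree is n - 1 - s. Hence it suffices that A and the extra
contributions together stay below s + (4l + 6) / (l ^ 2 - 2). The four `lt_of_...` lemmas prove this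
according to how many extra edges join two children of u and whether they meet; only the book, where
s = 0, escapes (`eq_star_of_large`). -/

/-! ### Sub-eigenvectors along a rooted tree with two extra edges -/

/-- The sum over the neighbours of `a` of the values of `y`, restricted to the edge `{p, q}`. -/
noncomputable def edgeContribution {W : Type*} [DecidableEq W] (y : W → ℝ) (p q a : W) : ℝ :=
  (if a = p then y q else 0) + (if a = q then y p else 0)

/-- A vector `y` with maximum `1`, attained at the root `u` of a tree with parent function `π`,
which satisfies `l * y ≤ A y` for the adjacency matrix `A` of the tree with the two additional
edges `{p₁, q₁}` and `{p₂, q₂}`, neither of which contains the root. -/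
structure IsTreeSubeigenvector {W : Type*} [Fintype W] [DecidableEq W] (u : W) (π : W → W)
    (p₁ q₁ p₂ q₂ : W) (y : W → ℝ) (l : ℝ) : Prop where
  nonneg : ∀ a, 0 ≤ y a
  le_one : ∀ a, y a ≤ 1
  root : y u = 1
  parent_ne : ∀ v, v ≠ u → π v ≠ v
  p₁_ne : p₁ ≠ u
  q₁_ne : q₁ ≠ u
  p₂_ne : p₂ ≠ u
  q₂_ne : q₂ ≠ u
  ne₁ : p₁ ≠ q₁
  ne₂ : p₂ ≠ q₂
  le_sum : ∀ a, l * y a ≤ (if a = u then 0 else y (π a)) + ∑ b with b ≠ u ∧ π b = a, y b +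
    edgeContribution y p₁ q₁ a + edgeContribution y p₂ q₂ a

section EdgeContribution

variable {W : Type*} [DecidableEq W] {y : W → ℝ}

theorem edgeContribution_nonneg (h : ∀ a, 0 ≤ y a) (p q a : W) : 0 ≤ edgeContribution y p q a := by
  unfold edgeContribution
  have := h p
  have := h q
  split_ifs <;> linarith

theorem edgeContribution_le_one (h : ∀ a, y a ≤ 1) {p q : W} (hpq : p ≠ q) (a : W) :
    edgeContribution y p q a ≤ 1 := by
  unfold edgeContribution
  have := h p
  have := h q
  split_ifs with h1 h2 h2
  · exact absurd (h1.symm.trans h2) hpq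
  all_goals linarith

theorem edgeContribution_of_ne {p q a : W} (hp : a ≠ p) (hq : a ≠ q) :
    edgeContribution y p q a = 0 := by
  simp [edgeContribution, hp, hq]

theorem edgeContribution_swap (p q : W) : edgeContribution y p q = edgeContribution y q p := by
  ext a
  simp [edgeContribution, add_comm]

theorem sum_edgeContribution (S : Finset W) (p q : W) :
    ∑ a ∈ S, edgeContribution y p q a =
      (if p ∈ S then y q else 0) + (if q ∈ S then y p else 0) := by
  simp [edgeContribution, Finset.sum_add_distrib]

end EdgeContribution

namespace IsTreeSubeigenvector

variable {W : Type*} [Fintype W] [DecidableEq W] {u : W} {π : W → W} {p₁ q₁ p₂ q₂ : W}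
  {y : W → ℝ} {l : ℝ}

theorem swap_edges (h : IsTreeSubeigenvector u π p₁ q₁ p₂ q₂ y l) :
    IsTreeSubeigenvector u π p₂ q₂ p₁ q₁ y l :=
  ⟨h.nonneg, h.le_one, h.root, h.parent_ne, h.p₂_ne, h.q₂_ne, h.p₁_ne, h.q₁_ne, h.ne₂, h.ne₁,
    fun a => by linarith [h.le_sum a]⟩

theorem swap_left (h : IsTreeSubeigenvector u π p₁ q₁ p₂ q₂ y l) :
    IsTreeSubeigenvector u π q₁ p₁ p₂ q₂ y l :=
  ⟨h.nonneg, h.le_one, h.root, h.parent_ne, h.q₁_ne, h.p₁_ne, h.p₂_ne, h.q₂_ne, h.ne₁.symm, h.ne₂,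
    fun a => by rw [edgeContribution_swap q₁ p₁]; exact h.le_sum a⟩

theorem swap_right (h : IsTreeSubeigenvector u π p₁ q₁ p₂ q₂ y l) :
    IsTreeSubeigenvector u π p₁ q₁ q₂ p₂ y l :=
  h.swap_edges.swap_left.swap_edges

end IsTreeSubeigenvector

/-! ### Counting and summing over the levels of the tree -/

section Levels

variable {W : Type*} [Fintype W] [DecidableEq W] (u : W) (π : W → W)

/-- The children of the root. -/
def levelOne : Finset W := {v | v ≠ u ∧ π v = u}

/-- The vertices which are neither the root nor a child of it. -/
def levelAbove : Finset W := {v | v ≠ u ∧ π v ≠ u}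

/-- The grandchildren of the root. -/
def levelTwo : Finset W := {v | v ≠ u ∧ π v ≠ u ∧ π (π v) = u}

variable {u π}

theorem mem_levelOne {v : W} : v ∈ levelOne u π ↔ v ≠ u ∧ π v = u := by simp [levelOne]

theorem mem_levelAbove {v : W} : v ∈ levelAbove u π ↔ v ≠ u ∧ π v ≠ u := by simp [levelAbove]

theorem mem_levelTwo {v : W} : v ∈ levelTwo u π ↔ v ≠ u ∧ π v ≠ u ∧ π (π v) = u := by
  simp [levelTwo]

theorem card_levels :
    (levelOne u π).card + (levelAbove u π).card + 1 = Fintype.card W := by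
  have h1 : (levelOne u π).card + (levelAbove u π).card = ({v | v ≠ u} : Finset W).card := by
    rw [← Finset.card_union_of_disjoint]
    · congr 1
      ext v
      simp only [Finset.mem_union, mem_levelOne, mem_levelAbove, Finset.mem_filter,
        Finset.mem_univ, true_and]
      tauto
    · rw [Finset.disjoint_left]
      intro v hv hv'
      exact (mem_levelAbove.1 hv').2 (mem_levelOne.1 hv).2
  rw [h1, Finset.filter_ne', Finset.card_erase_of_mem (Finset.mem_univ _), Finset.card_univ]
  have : 0 < Fintype.card W := Fintype.card_pos_iff.2 ⟨u⟩
  omega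

theorem sum_children_levelOne (y : W → ℝ) :
    ∑ v ∈ levelOne u π, ∑ b with b ≠ u ∧ π b = v, y b = ∑ b ∈ levelTwo u π, y b := by
  rw [← Finset.sum_fiberwise_of_maps_to (s := levelTwo u π) (t := levelOne u π) (g := π)]
  · refine Finset.sum_congr rfl fun v hv => Finset.sum_congr ?_ fun _ _ => rfl
    rw [mem_levelOne] at hv
    ext b
    simp only [Finset.mem_filter, Finset.mem_univ, true_and, mem_levelTwo]
    constructor
    · rintro ⟨hb, rfl⟩
      exact ⟨⟨hb, hv⟩, rfl⟩
    · rintro ⟨⟨hb, -⟩, rfl⟩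
      exact ⟨hb, rfl⟩
  · intro x hx
    rw [mem_levelTwo] at hx
    exact mem_levelOne.2 hx.2

/-- Distinct grandchildren have disjoint sets of children, and these lie in `levelAbove` outside
`levelTwo`. Thus each vertex of `levelAbove` is charged at most 1. -/
theorem sum_children_levelTwo {y : W → ℝ} (h0 : ∀ a, 0 ≤ y a) (h1 : ∀ a, y a ≤ 1) :
    ∑ v ∈ levelTwo u π, ∑ b with b ≠ u ∧ π b = v, y b + (levelTwo u π).card
      ≤ (levelAbove u π).card := by
  have hsub : levelTwo u π ⊆ levelAbove u π := fun v hv =>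
    mem_levelAbove.2 ⟨(mem_levelTwo.1 hv).1, (mem_levelTwo.1 hv).2.1⟩
  have hle : ∑ v ∈ levelTwo u π, ∑ b with b ≠ u ∧ π b = v, y b
      ≤ ∑ b ∈ levelAbove u π \ levelTwo u π, y b := by
    rw [← Finset.sum_biUnion]
    · refine Finset.sum_le_sum_of_subset_of_nonneg ?_ fun b _ _ => h0 b
      intro b hb
      simp only [Finset.mem_biUnion, mem_levelTwo, Finset.mem_filter, Finset.mem_univ,
        true_and] at hb
      obtain ⟨v, hv, hb, rfl⟩ := hb
      simp only [Finset.mem_sdiff, mem_levelAbove, mem_levelTwo]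
      tauto
    · intro v _ w _ hvw
      rw [Function.onFun, Finset.disjoint_left]
      intro b hb hb'
      simp only [Finset.mem_filter] at hb hb'
      exact hvw (hb.2.2.symm.trans hb'.2.2)
  have h2 : ∑ b ∈ levelAbove u π \ levelTwo u π, y b ≤ (levelAbove u π \ levelTwo u π).card := by
    refine (Finset.sum_le_sum fun b _ => h1 b).trans ?_
    simp
  have h3 := Finset.card_sdiff_add_card_eq_card hsub
  have h4 : ((levelAbove u π \ levelTwo u π).card : ℝ) + (levelTwo u π).card
      = (levelAbove u π).card := by exact_mod_cast h3
  linarith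

end Levels

/-! ### Estimates for sub-eigenvectors and the cases for the two extra edges -/

namespace IsTreeSubeigenvector

variable {W : Type*} [Fintype W] [DecidableEq W] {u : W} {π : W → W} {p₁ q₁ p₂ q₂ : W}
  {y : W → ℝ} {l : ℝ}

/-- At the root the inequality reads `l ≤ ∑ y v` over the children, as no extra edge meets the root.
Multiplying by `l` and using the inequality at every child, whose parent has value 1, gives the
bound. -/
theorem sq_le (h : IsTreeSubeigenvector u π p₁ q₁ p₂ q₂ y l) (hl : 0 ≤ l) :
    l ^ 2 ≤ (levelOne u π).card + ∑ b ∈ levelTwo u π, y b +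
      ∑ a ∈ levelOne u π, edgeContribution y p₁ q₁ a +
      ∑ a ∈ levelOne u π, edgeContribution y p₂ q₂ a := by
  have h1 : l ≤ ∑ v ∈ levelOne u π, y v := by
    have := h.le_sum u
    rw [edgeContribution_of_ne h.p₁_ne.symm h.q₁_ne.symm,
      edgeContribution_of_ne h.p₂_ne.symm h.q₂_ne.symm, h.root] at this
    simpa [levelOne] using this
  have h2 : ∑ v ∈ levelOne u π, l * y v ≤ ∑ v ∈ levelOne u π,
      (1 + ∑ b with b ≠ u ∧ π b = v, y b + edgeContribution y p₁ q₁ v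
        + edgeContribution y p₂ q₂ v) := by
    refine Finset.sum_le_sum fun v hv => ?_
    rw [mem_levelOne] at hv
    have := h.le_sum v
    rwa [if_neg hv.1, hv.2, h.root] at this
  rw [Finset.sum_add_distrib, Finset.sum_add_distrib, Finset.sum_add_distrib,
    sum_children_levelOne, ← Finset.mul_sum] at h2
  simp only [Finset.sum_const, nsmul_eq_mul, mul_one] at h2
  nlinarith

/-- Add the inequalities at the grandchildren: their parents count at most 1 each, and
`sum_children_levelTwo` absorbs these together with their children into `s = (levelAbove u π).card`.
-/
theorem mul_sum_levelTwo_le (h : IsTreeSubeigenvector u π p₁ q₁ p₂ q₂ y l) :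
    l * ∑ b ∈ levelTwo u π, y b ≤ (levelAbove u π).card +
      ∑ a ∈ levelTwo u π, edgeContribution y p₁ q₁ a +
      ∑ a ∈ levelTwo u π, edgeContribution y p₂ q₂ a := by
  have h2 : ∑ v ∈ levelTwo u π, l * y v ≤ ∑ v ∈ levelTwo u π,
      (1 + ∑ b with b ≠ u ∧ π b = v, y b + edgeContribution y p₁ q₁ v
        + edgeContribution y p₂ q₂ v) := by
    refine Finset.sum_le_sum fun v hv => ?_
    rw [mem_levelTwo] at hv
    have h3 := h.le_sum v
    rw [if_neg hv.1] at h3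
    linarith [h.le_one (π v)]
  rw [Finset.sum_add_distrib, Finset.sum_add_distrib, Finset.sum_add_distrib,
    ← Finset.mul_sum] at h2
  simp only [Finset.sum_const, nsmul_eq_mul, mul_one] at h2
  linarith [sum_children_levelTwo (u := u) (π := π) h.nonneg h.le_one]

/-- The parent of `r` contributes at most 1, and its children are among the other vertices of
`levelAbove`; here `parent_ne` excludes `r` itself. -/
theorem mul_le_of_mem_levelAbove (h : IsTreeSubeigenvector u π p₁ q₁ p₂ q₂ y l) {r : W}
    (hr : r ∈ levelAbove u π) :
    l * y r ≤ (levelAbove u π).card + edgeContribution y p₁ q₁ r + edgeContribution y p₂ q₂ r := by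
  have hr' := mem_levelAbove.1 hr
  have h1 := h.le_sum r
  rw [if_neg hr'.1] at h1
  have h2 : ∑ b with b ≠ u ∧ π b = r, y b ≤ ((levelAbove u π).erase r).card := by
    calc ∑ b with b ≠ u ∧ π b = r, y b ≤ ∑ b ∈ (levelAbove u π).erase r, y b := by
          refine Finset.sum_le_sum_of_subset_of_nonneg ?_ fun b _ _ => h.nonneg b
          intro b hb
          simp only [Finset.mem_filter, Finset.mem_univ, true_and] at hb
          obtain ⟨hb, rfl⟩ := hb
          exact Finset.mem_erase.2 ⟨fun e => h.parent_ne b hb e.symm, mem_levelAbove.2 ⟨hb, hr'.1⟩⟩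
      _ ≤ ((levelAbove u π).erase r).card := by
          refine (Finset.sum_le_sum fun b _ => h.le_one b).trans ?_
          simp
  have h3 : (((levelAbove u π).erase r).card : ℝ) + 1 = (levelAbove u π).card := by
    exact_mod_cast Finset.card_erase_add_one hr
  linarith [h.le_one (π r)]

/-- An additional edge that does not join two children of the root contributes little. -/
theorem contribution_of_not_levelOne (h : IsTreeSubeigenvector u π p₁ q₁ p₂ q₂ y l)
    (hn : ¬ (π p₁ = u ∧ π q₁ = u)) :
    (∑ a ∈ levelOne u π, edgeContribution y p₁ q₁ a = 0 ∧
      ∑ a ∈ levelTwo u π, edgeContribution y p₁ q₁ a ≤ 2) ∨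
    ∃ r ∈ levelAbove u π, ∑ a ∈ levelOne u π, edgeContribution y p₁ q₁ a ≤ y r ∧
      ∑ a ∈ levelTwo u π, edgeContribution y p₁ q₁ a ≤ 1 := by
  simp only [sum_edgeContribution, mem_levelOne, mem_levelTwo, mem_levelAbove]
  have hp := h.le_one p₁
  have hq := h.le_one q₁
  have := h.p₁_ne
  have := h.q₁_ne
  by_cases h1 : π p₁ = u
  · have h2 : π q₁ ≠ u := fun h2 => hn ⟨h1, h2⟩
    refine Or.inr ⟨q₁, ⟨h.q₁_ne, h2⟩, ?_, ?_⟩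
    · simp [h1, h2, h.p₁_ne]
    · simp only [h1]
      simp only [ne_eq, not_true_eq_false, false_and, and_false, if_false, zero_add]
      split_ifs <;> linarith
  · by_cases h2 : π q₁ = u
    · refine Or.inr ⟨p₁, ⟨h.p₁_ne, h1⟩, ?_, ?_⟩
      · simp [h1, h2, h.q₁_ne]
      · simp only [h2]
        simp only [ne_eq, not_true_eq_false, false_and, and_false, if_false, add_zero]
        split_ifs <;> linarith
    · left
      refine ⟨by simp [h1, h2], ?_⟩
      split_ifs <;> linarith

/-- The combination is the one that enters `l * (A + ...)` once `mul_sum_levelTwo_le` is used. The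
first bound comes from `y r ≤ 1` and serves small `l`; the second, from `l * y r ≤ s + 2`, serves
large `l`. -/
theorem contribution_bounds_of_not_levelOne (h : IsTreeSubeigenvector u π p₁ q₁ p₂ q₂ y l)
    (hl : 1 ≤ l) (hn : ¬ (π p₁ = u ∧ π q₁ = u)) :
    l * ∑ a ∈ levelOne u π, edgeContribution y p₁ q₁ a +
      ∑ a ∈ levelTwo u π, edgeContribution y p₁ q₁ a ≤ l + 1 ∧
    l * ∑ a ∈ levelOne u π, edgeContribution y p₁ q₁ a +
      ∑ a ∈ levelTwo u π, edgeContribution y p₁ q₁ a ≤ (levelAbove u π).card + 3 := by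
  rcases h.contribution_of_not_levelOne hn with ⟨h1, h2⟩ | ⟨r, hr, h1, h2⟩
  · rw [h1]
    have : (0 : ℝ) ≤ (levelAbove u π).card := by positivity
    constructor <;> linarith
  · have h3 := h.mul_le_of_mem_levelAbove hr
    have h4 := h.le_one r
    have h5 := edgeContribution_le_one h.le_one h.ne₁ r
    have h6 := edgeContribution_le_one h.le_one h.ne₂ r
    constructor <;> nlinarith

theorem one_le_card_levelAbove (h : IsTreeSubeigenvector u π p₁ q₁ p₂ q₂ y l)
    (hn : ¬ (π p₁ = u ∧ π q₁ = u)) : (1 : ℝ) ≤ (levelAbove u π).card := by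
  have : (levelAbove u π).Nonempty := by
    by_cases h1 : π p₁ = u
    · exact ⟨q₁, mem_levelAbove.2 ⟨h.q₁_ne, fun h2 => hn ⟨h1, h2⟩⟩⟩
    · exact ⟨p₁, mem_levelAbove.2 ⟨h.p₁_ne, h1⟩⟩
  exact_mod_cast this.card_pos

/-- No additional edge joins two children of the root. -/
theorem lt_of_not_levelOne_of_not_levelOne (h : IsTreeSubeigenvector u π p₁ q₁ p₂ q₂ y l)
    (hl : 67 / 25 ≤ l) (hn₁ : ¬ (π p₁ = u ∧ π q₁ = u)) (hn₂ : ¬ (π p₂ = u ∧ π q₂ = u)) :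
    ∑ b ∈ levelTwo u π, y b + ∑ a ∈ levelOne u π, edgeContribution y p₁ q₁ a +
      ∑ a ∈ levelOne u π, edgeContribution y p₂ q₂ a
      < (levelAbove u π).card + (4 * l + 6) / (l ^ 2 - 2) := by
  have hs := h.one_le_card_levelAbove hn₁
  have h0 := h.mul_sum_levelTwo_le
  obtain ⟨h1, h2⟩ := h.contribution_bounds_of_not_levelOne (by linarith) hn₁
  obtain ⟨h3, h4⟩ := h.swap_edges.contribution_bounds_of_not_levelOne (by linarith) hn₂
  generalize ((levelAbove u π).card : ℝ) = s at *
  set A := ∑ b ∈ levelTwo u π, y b + ∑ a ∈ levelOne u π, edgeContribution y p₁ q₁ a +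
      ∑ a ∈ levelOne u π, edgeContribution y p₂ q₂ a with hA
  have hd : 0 < l ^ 2 - 2 := by nlinarith
  have hl0 : 0 < l := by linarith
  rw [← sub_lt_iff_lt_add', lt_div_iff₀ hd]
  refine lt_of_mul_lt_mul_left ?_ hl0.le
  rw [← mul_assoc]
  -- Using the first bounds leaves `2 * l + 2 + (1 - l) * s`, using the second `6 + (3 - l) * s`. In
  -- the respective ranges the worst case is `s = 1`.
  rcases le_total l 3 with hl3 | hl3
  · have : l * (A - s) ≤ l + 3 := by nlinarith
    calc l * (A - s) * (l ^ 2 - 2) ≤ (l + 3) * (l ^ 2 - 2) := by gcongr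
      _ < l * (4 * l + 6) := by nlinarith
  · have : l * (A - s) ≤ 9 - l := by nlinarith
    calc l * (A - s) * (l ^ 2 - 2) ≤ (9 - l) * (l ^ 2 - 2) := by gcongr
      _ < l * (4 * l + 6) := by nlinarith [mul_nonneg (sq_nonneg (l - 3)) hl0.le]

theorem sum_children_le (h : IsTreeSubeigenvector u π p₁ q₁ p₂ q₂ y l) {S : Finset W}
    (hS : S ⊆ levelOne u π) :
    ∑ v ∈ S, ∑ b with b ≠ u ∧ π b = v, y b ≤ ∑ b ∈ levelTwo u π, y b := by
  rw [← sum_children_levelOne]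
  exact Finset.sum_le_sum_of_subset_of_nonneg hS fun v _ _ =>
    Finset.sum_nonneg fun b _ => h.nonneg b

theorem contribution_of_levelOne (h : IsTreeSubeigenvector u π p₁ q₁ p₂ q₂ y l)
    (hp : π p₁ = u) (hq : π q₁ = u) :
    ∑ a ∈ levelOne u π, edgeContribution y p₁ q₁ a = y q₁ + y p₁ ∧
    ∑ a ∈ levelTwo u π, edgeContribution y p₁ q₁ a = 0 := by
  simp [sum_edgeContribution, mem_levelOne, mem_levelTwo, hp, hq, h.p₁_ne, h.q₁_ne]

theorem mul_le_of_levelOne (h : IsTreeSubeigenvector u π p₁ q₁ p₂ q₂ y l) {v : W} (hv : v ≠ u)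
    (hp : π v = u) :
    l * y v ≤ 1 + ∑ b with b ≠ u ∧ π b = v, y b + edgeContribution y p₁ q₁ v +
      edgeContribution y p₂ q₂ v := by
  have := h.le_sum v
  rwa [if_neg hv, hp, h.root] at this

/-- Exactly one additional edge joins two children of the root. -/
theorem lt_of_levelOne_of_not_levelOne (h : IsTreeSubeigenvector u π p₁ q₁ p₂ q₂ y l)
    (hl : 67 / 25 ≤ l) (hp : π p₁ = u) (hq : π q₁ = u) (hn₂ : ¬ (π p₂ = u ∧ π q₂ = u)) :
    ∑ b ∈ levelTwo u π, y b + ∑ a ∈ levelOne u π, edgeContribution y p₁ q₁ a +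
      ∑ a ∈ levelOne u π, edgeContribution y p₂ q₂ a
      < (levelAbove u π).card + (4 * l + 6) / (l ^ 2 - 2) := by
  have hs := h.swap_edges.one_le_card_levelAbove hn₂
  have h0 := h.mul_sum_levelTwo_le
  obtain ⟨hx, hx'⟩ := h.contribution_of_levelOne hp hq
  rw [hx'] at h0
  have hsub : ({p₁, q₁} : Finset W) ⊆ levelOne u π := by
    intro v hv
    simp only [Finset.mem_insert, Finset.mem_singleton] at hv
    rcases hv with rfl | rfl
    exacts [mem_levelOne.2 ⟨h.p₁_ne, hp⟩, mem_levelOne.2 ⟨h.q₁_ne, hq⟩]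
  have hch := h.sum_children_le hsub
  have hg : ∑ v ∈ ({p₁, q₁} : Finset W), edgeContribution y p₂ q₂ v
      ≤ ∑ v ∈ levelOne u π, edgeContribution y p₂ q₂ v :=
    Finset.sum_le_sum_of_subset_of_nonneg hsub fun v _ _ =>
      edgeContribution_nonneg h.nonneg _ _ _
  rw [Finset.sum_pair h.ne₁] at hch hg
  have h1 := h.mul_le_of_levelOne h.p₁_ne hp
  have h2 := h.mul_le_of_levelOne h.q₁_ne hq
  have h3 : edgeContribution y p₁ q₁ p₁ = y q₁ := by simp [edgeContribution, h.ne₁]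
  have h4 : edgeContribution y p₁ q₁ q₁ = y p₁ := by simp [edgeContribution, h.ne₁.symm]
  rw [h3] at h1
  rw [h4] at h2
  rw [hx]
  have hx2 := h.swap_edges.contribution_of_not_levelOne hn₂
  have hr : ∀ r ∈ levelAbove u π, l * y r ≤ (levelAbove u π).card + 1 ∧ y r ≤ 1 := by
    intro r hr
    have h5 := h.mul_le_of_mem_levelAbove hr
    have hr' := mem_levelAbove.1 hr
    rw [edgeContribution_of_ne (p := p₁) (q := q₁) (by rintro rfl; exact hr'.2 hp)
      (by rintro rfl; exact hr'.2 hq)] at h5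
    have h6 := edgeContribution_le_one h.le_one h.ne₂ r
    exact ⟨by linarith, h.le_one r⟩
  generalize ((levelAbove u π).card : ℝ) = s at *
  generalize ∑ b ∈ levelTwo u π, y b = A at *
  generalize ∑ a ∈ levelOne u π, edgeContribution y p₂ q₂ a = t at *
  generalize ∑ a ∈ levelTwo u π, edgeContribution y p₂ q₂ a = t' at *
  -- Sum of the inequalities at `p₁` and `q₁`; each end sees the other across the extra edge, which
  -- turns the factor `l` into `l - 1`.
  have h5 : (l - 1) * (y p₁ + y q₁) ≤ 2 + A + t := by linarith
  have hxt : (t = 0 ∧ t' ≤ 2) ∨ (t ≤ 1 ∧ l * t ≤ s + 1 ∧ t' ≤ 1) := by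
    rcases hx2 with hx2 | ⟨r, hr1, hr2, hr3⟩
    · exact Or.inl hx2
    · refine Or.inr ⟨hr2.trans (hr r hr1).2, ?_, hr3⟩
      have := (hr r hr1).1
      nlinarith
  clear hx2 hr hg hch h1 h2 h3 h4 hx hx' hsub
  have hd : 0 < l ^ 2 - 2 := by nlinarith
  have hl1 : 0 < l - 1 := by linarith
  rw [← sub_lt_iff_lt_add', lt_div_iff₀ hd]
  refine lt_of_mul_lt_mul_left ?_ hl1.le
  rw [← mul_assoc]
  set Q := A + (y q₁ + y p₁) + t - s with hQ
  have h6 : (l - 1) * Q ≤ 2 + l * A + l * t - (l - 1) * s := by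
    have : (l - 1) * Q = (l - 1) * (y p₁ + y q₁) + (l - 1) * A + (l - 1) * t - (l - 1) * s := by
      rw [hQ]; ring
    linarith
  have hQ' : (l - 1) * Q ≤ 2 + s + t' + l * t - (l - 1) * s := by linarith
  -- As in the previous case: `t ≤ 1` for small `l`, `l * t ≤ s + 1` for large `l`, and the worst
  -- case is `s = 1`.
  rcases le_total l 3 with hl3 | hl3
  · have : (l - 1) * Q ≤ 5 := by
      rcases hxt with ⟨rfl, h7⟩ | ⟨h7, h8, h9⟩ <;> nlinarith
    calc (l - 1) * Q * (l ^ 2 - 2) ≤ 5 * (l ^ 2 - 2) := by gcongr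
      _ < (l - 1) * (4 * l + 6) := by nlinarith
  · have : (l - 1) * Q ≤ 7 - l := by
      rcases hxt with ⟨rfl, h7⟩ | ⟨h7, h8, h9⟩ <;> nlinarith
    calc (l - 1) * Q * (l ^ 2 - 2) ≤ (7 - l) * (l ^ 2 - 2) := by gcongr
      _ < (l - 1) * (4 * l + 6) := by nlinarith [mul_nonneg (sub_nonneg.2 hl3) (sq_nonneg l)]

/-- The additional edges are disjoint and join children of the root. -/
theorem lt_of_disjoint (h : IsTreeSubeigenvector u π p₁ q₁ p₂ q₂ y l)
    (hl : 67 / 25 ≤ l) (hp₁ : π p₁ = u) (hq₁ : π q₁ = u) (hp₂ : π p₂ = u) (hq₂ : π q₂ = u)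
    (hpp : p₁ ≠ p₂) (hpq : p₁ ≠ q₂) (hqp : q₁ ≠ p₂) (hqq : q₁ ≠ q₂) :
    ∑ b ∈ levelTwo u π, y b + ∑ a ∈ levelOne u π, edgeContribution y p₁ q₁ a +
      ∑ a ∈ levelOne u π, edgeContribution y p₂ q₂ a
      < (levelAbove u π).card + (4 * l + 6) / (l ^ 2 - 2) := by
  have h0 := h.mul_sum_levelTwo_le
  obtain ⟨hx, hx'⟩ := h.contribution_of_levelOne hp₁ hq₁
  obtain ⟨hz, hz'⟩ := h.swap_edges.contribution_of_levelOne hp₂ hq₂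
  rw [hx', hz'] at h0
  have hsub : ({p₁, q₁, p₂, q₂} : Finset W) ⊆ levelOne u π := by
    intro v hv
    simp only [Finset.mem_insert, Finset.mem_singleton] at hv
    rcases hv with rfl | rfl | rfl | rfl
    exacts [mem_levelOne.2 ⟨h.p₁_ne, hp₁⟩, mem_levelOne.2 ⟨h.q₁_ne, hq₁⟩,
      mem_levelOne.2 ⟨h.p₂_ne, hp₂⟩, mem_levelOne.2 ⟨h.q₂_ne, hq₂⟩]
  have hch := h.sum_children_le hsub
  rw [Finset.sum_insert (by simp [hpp, hpq, h.ne₁]), Finset.sum_insert (by simp [hqp, hqq]),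
    Finset.sum_pair h.ne₂] at hch
  have h1 := h.mul_le_of_levelOne h.p₁_ne hp₁
  have h2 := h.mul_le_of_levelOne h.q₁_ne hq₁
  have h3 := h.mul_le_of_levelOne h.p₂_ne hp₂
  have h4 := h.mul_le_of_levelOne h.q₂_ne hq₂
  simp only [edgeContribution, if_true, if_neg h.ne₁, if_neg h.ne₁.symm, if_neg h.ne₂,
    if_neg h.ne₂.symm, if_neg hpp, if_neg hpq, if_neg hqp, if_neg hqq, if_neg hpp.symm,
    if_neg hpq.symm, if_neg hqp.symm, if_neg hqq.symm, add_zero, zero_add] at h1 h2 h3 h4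
  rw [hx, hz]
  have hs : (0 : ℝ) ≤ (levelAbove u π).card := by positivity
  generalize ((levelAbove u π).card : ℝ) = s at *
  generalize ∑ b ∈ levelTwo u π, y b = A at *
  have hd : 0 < l ^ 2 - 2 := by nlinarith
  have hl1 : 0 < l - 1 := by linarith
  rw [← sub_lt_iff_lt_add', lt_div_iff₀ hd]
  refine lt_of_mul_lt_mul_left ?_ hl1.le
  rw [← mul_assoc]
  set Q := A + (y q₁ + y p₁) + (y q₂ + y p₂) - s with hQ
  -- The four inequalities at the ends add up to `l - 1` times their total weight being at most `4 +
  -- A`; then `l * A ≤ s` leaves `4 + (2 - l) * s`.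
  have : (l - 1) * Q ≤ 4 := by
    have : (l - 1) * Q ≤ 4 + l * A - (l - 1) * s := by
      rw [hQ]; linarith
    nlinarith
  calc (l - 1) * Q * (l ^ 2 - 2) ≤ 4 * (l ^ 2 - 2) := by gcongr
    _ < (l - 1) * (4 * l + 6) := by nlinarith

/-- The additional edges share a vertex and join children of the root. -/
theorem lt_of_common {c p q : W} (h : IsTreeSubeigenvector u π c p c q y l)
    (hl : 67 / 25 ≤ l) (hc : π c = u) (hp : π p = u) (hq : π q = u) (hpq : p ≠ q)
    (hs : (1 : ℝ) ≤ (levelAbove u π).card) :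
    ∑ b ∈ levelTwo u π, y b + ∑ a ∈ levelOne u π, edgeContribution y c p a +
      ∑ a ∈ levelOne u π, edgeContribution y c q a
      < (levelAbove u π).card + (4 * l + 6) / (l ^ 2 - 2) := by
  have h0 := h.mul_sum_levelTwo_le
  obtain ⟨hx, hx'⟩ := h.contribution_of_levelOne hc hp
  obtain ⟨hz, hz'⟩ := h.swap_edges.contribution_of_levelOne hc hq
  rw [hx', hz'] at h0
  have hcp := h.ne₁
  have hcq := h.ne₂
  have hsub : ({c, p, q} : Finset W) ⊆ levelOne u π := by
    intro v hv
    simp only [Finset.mem_insert, Finset.mem_singleton] at hv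
    rcases hv with rfl | rfl | rfl
    exacts [mem_levelOne.2 ⟨h.p₁_ne, hc⟩, mem_levelOne.2 ⟨h.q₁_ne, hp⟩,
      mem_levelOne.2 ⟨h.q₂_ne, hq⟩]
  have hch := h.sum_children_le hsub
  rw [Finset.sum_insert (by simp [hcp, hcq]), Finset.sum_pair hpq] at hch
  have h1 := h.mul_le_of_levelOne h.p₁_ne hc
  have h2 := h.mul_le_of_levelOne h.q₁_ne hp
  have h3 := h.mul_le_of_levelOne h.q₂_ne hq
  simp only [edgeContribution, if_true, if_neg hcp, if_neg hcp.symm, if_neg hcq,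
    if_neg hcq.symm, if_neg hpq, if_neg hpq.symm, add_zero, zero_add] at h1 h2 h3
  have c1 : 0 ≤ ∑ b with b ≠ u ∧ π b = c, y b := Finset.sum_nonneg fun b _ => h.nonneg b
  have c2 : 0 ≤ ∑ b with b ≠ u ∧ π b = p, y b := Finset.sum_nonneg fun b _ => h.nonneg b
  have c3 : 0 ≤ ∑ b with b ≠ u ∧ π b = q, y b := Finset.sum_nonneg fun b _ => h.nonneg b
  rw [hx, hz]
  generalize ((levelAbove u π).card : ℝ) = s at *
  generalize ∑ b ∈ levelTwo u π, y b = A at *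
  generalize ∑ b with b ≠ u ∧ π b = c, y b = C at *
  generalize ∑ b with b ≠ u ∧ π b = p, y b = P at *
  generalize ∑ b with b ≠ u ∧ π b = q, y b = P' at *
  have hd : 0 < l ^ 2 - 2 := by nlinarith
  have hl0 : 0 < l := by linarith
  rw [← sub_lt_iff_lt_add', lt_div_iff₀ hd]
  -- The multipliers `2 * l + 2` and `l + 2` solve the system for `2 * y c + y p + y q` with
  -- determinant `l ^ 2 - 2`, and the constants add up to `4 * l + 6`. So the comparison is exact
  -- for the book, and the strictness must come from `s ≥ 1`.
  have e1 : (2 * l + 2) * (l * y c) ≤ (2 * l + 2) * (1 + C + y p + y q) := by gcongr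
  have e2 : (l + 2) * (l * (y p + y q)) ≤ (l + 2) * (2 + P + P' + 2 * y c) := by
    gcongr; linarith
  have e3 : (2 * y c + y p + y q) * (l ^ 2 - 2) ≤ 4 * l + 6 + (2 * l + 2) * A := by
    have : (2 * l + 2) * (C + P + P') ≤ (2 * l + 2) * A := by gcongr; linarith
    have : 0 ≤ l * (P + P') := by positivity
    nlinarith
  -- The total coefficient of `A` is `l ^ 2 + 2 * l`. Since `l * A ≤ s`, the loss is at least `s *
  -- (l ^ 2 - l - 4)`, positive as `l` exceeds `(1 + √17) / 2`.
  have e4 : (A - s) * (l ^ 2 - 2) + (2 * l + 2) * A < 0 := by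
    have e5 : (l ^ 2 + 2 * l) * (l * A) ≤ (l ^ 2 + 2 * l) * s := by gcongr; linarith
    have e6 : 0 < s * (l ^ 2 - l - 4) := mul_pos (by linarith) (by nlinarith)
    have e7 : l * ((A - s) * (l ^ 2 - 2) + (2 * l + 2) * A) ≤ - (l * (s * (l ^ 2 - l - 4))) := by
      nlinarith
    by_contra hcon
    push Not at hcon
    have := mul_nonneg hl0.le hcon
    have := mul_pos hl0 e6
    linarith
  nlinarith

/-- A tree with two additional edges that has a sub-eigenvector of large eigenvalue is a star with
two additional edges that share a vertex. -/
theorem eq_star_of_large (h : IsTreeSubeigenvector u π p₁ q₁ p₂ q₂ y l) (hl : 67 / 25 ≤ l)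
    (hne : s(p₁, q₁) ≠ s(p₂, q₂))
    (hlarge : (Fintype.card W : ℝ) - 1 + (4 * l + 6) / (l ^ 2 - 2) ≤ l ^ 2) :
    (∀ v, v ≠ u → π v = u) ∧
      ∃ c p q, c ≠ u ∧ p ≠ u ∧ q ≠ u ∧ c ≠ p ∧ c ≠ q ∧ p ≠ q ∧
        ((s(p₁, q₁) = s(c, p) ∧ s(p₂, q₂) = s(c, q))) := by
  have hcard : ((levelOne u π).card : ℝ) + (levelAbove u π).card + 1 = Fintype.card W := by
    exact_mod_cast card_levels
  -- Through `sq_le` and `card_levels`, the strict estimate would contradict `hlarge`.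
  have hcontra : ∀ {p₁ q₁ p₂ q₂ : W}, IsTreeSubeigenvector u π p₁ q₁ p₂ q₂ y l →
      ¬ (∑ b ∈ levelTwo u π, y b + ∑ a ∈ levelOne u π, edgeContribution y p₁ q₁ a +
      ∑ a ∈ levelOne u π, edgeContribution y p₂ q₂ a
      < (levelAbove u π).card + (4 * l + 6) / (l ^ 2 - 2)) := by
    intro p₁ q₁ p₂ q₂ h hlt
    have := h.sq_le (by linarith)
    linarith
  by_cases h1 : π p₁ = u ∧ π q₁ = u
  · by_cases h2 : π p₂ = u ∧ π q₂ = u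
    · have hcommon : ∀ {c p q : W}, IsTreeSubeigenvector u π c p c q y l → π c = u → π p = u →
          π q = u → p ≠ q → (∀ v, v ≠ u → π v = u) ∧
          c ≠ u ∧ p ≠ u ∧ q ≠ u ∧ c ≠ p ∧ c ≠ q ∧ p ≠ q := by
        intro c p q h hc hp hq hpq
        refine ⟨?_, h.p₁_ne, h.q₁_ne, h.q₂_ne, h.ne₁, h.ne₂, hpq⟩
        by_contra hcon
        push Not at hcon
        obtain ⟨v, hv, hv'⟩ := hcon
        have : (1 : ℝ) ≤ (levelAbove u π).card := by
          exact_mod_cast Finset.card_pos.2 ⟨v, mem_levelAbove.2 ⟨hv, hv'⟩⟩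
        exact hcontra h (h.lt_of_common hl hc hp hq hpq this)
      by_cases e1 : p₁ = p₂
      · subst e1
        obtain ⟨ha, hb⟩ := hcommon h h1.1 h1.2 h2.2 (by rintro rfl; exact hne rfl)
        exact ⟨ha, p₁, q₁, q₂, hb.1, hb.2.1, hb.2.2.1, hb.2.2.2.1, hb.2.2.2.2.1, hb.2.2.2.2.2,
          rfl, rfl⟩
      by_cases e2 : p₁ = q₂
      · subst e2
        obtain ⟨ha, hb⟩ := hcommon h.swap_right h1.1 h1.2 h2.1
          (by rintro rfl; exact hne Sym2.eq_swap)
        exact ⟨ha, p₁, q₁, p₂, hb.1, hb.2.1, hb.2.2.1, hb.2.2.2.1, hb.2.2.2.2.1, hb.2.2.2.2.2,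
          rfl, Sym2.eq_swap⟩
      by_cases e3 : q₁ = p₂
      · subst e3
        obtain ⟨ha, hb⟩ := hcommon h.swap_left h1.2 h1.1 h2.2
          (by rintro rfl; exact hne Sym2.eq_swap)
        exact ⟨ha, q₁, p₁, q₂, hb.1, hb.2.1, hb.2.2.1, hb.2.2.2.1, hb.2.2.2.2.1, hb.2.2.2.2.2,
          Sym2.eq_swap, rfl⟩
      by_cases e4 : q₁ = q₂
      · subst e4
        obtain ⟨ha, hb⟩ := hcommon h.swap_left.swap_right h1.2 h1.1 h2.1
          (by rintro rfl; exact hne rfl)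
        exact ⟨ha, q₁, p₁, p₂, hb.1, hb.2.1, hb.2.2.1, hb.2.2.2.1, hb.2.2.2.2.1, hb.2.2.2.2.2,
          Sym2.eq_swap, Sym2.eq_swap⟩
      exact absurd (h.lt_of_disjoint hl h1.1 h1.2 h2.1 h2.2 e1 e2 e3 e4) (hcontra h)
    · exact absurd (h.lt_of_levelOne_of_not_levelOne hl h1.1 h1.2 h2) (hcontra h)
  · by_cases h2 : π p₂ = u ∧ π q₂ = u
    · exact absurd (h.swap_edges.lt_of_levelOne_of_not_levelOne hl h2.1 h2.2 h1)
        (hcontra h.swap_edges)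
    · exact absurd (h.lt_of_not_levelOne_of_not_levelOne hl h1 h2) (hcontra h)

end IsTreeSubeigenvector

/-! ### Connected graphs with one more edge than vertices -/

namespace SimpleGraph

/-- A star with center `u` and two additional edges `{c, p}` and `{c, q}`, so that two triangles
share the edge `{u, c}`. -/
def IsBook {W : Type*} (G : SimpleGraph W) : Prop :=
  ∃ u c p q : W, (u ≠ c ∧ u ≠ p ∧ u ≠ q ∧ c ≠ p ∧ c ≠ q ∧ p ≠ q) ∧
    ∀ x y, G.Adj x y ↔ x ≠ y ∧ (x = u ∨ y = u ∨ s(x, y) = s(c, p) ∨ s(x, y) = s(c, q))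

/-- A connected graph with one more edge than vertices is a breadth-first search tree with two
additional edges. -/
theorem exists_tree_add_two_edges {W : Type*} [Fintype W] [DecidableEq W] {G : SimpleGraph W}
    (hc : G.Connected) (hE : Nat.card G.edgeSet = Fintype.card W + 1) (u : W) :
    ∃ (π : W → W) (p₁ q₁ p₂ q₂ : W),
      (∀ v, v ≠ u → π v ≠ v) ∧ (p₁ ≠ u ∧ q₁ ≠ u ∧ p₂ ≠ u ∧ q₂ ≠ u) ∧
      s(p₁, q₁) ≠ s(p₂, q₂) ∧
      ∀ a b, G.Adj a b ↔ (a ≠ u ∧ b = π a) ∨ (b ≠ u ∧ a = π b) ∨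
        s(a, b) = s(p₁, q₁) ∨ s(a, b) = s(p₂, q₂) := by
  classical
  have hpar : ∀ v, ∃ w, v ≠ u → G.Adj v w ∧ G.dist u w + 1 = G.dist u v := by
    intro v
    by_cases hv : v = u
    · exact ⟨u, fun h => absurd hv h⟩
    obtain ⟨p, hp⟩ := hc.exists_walk_length_eq_dist v u
    cases p with
    | nil => exact absurd rfl hv
    | cons hadj p =>
      rename_i w
      refine ⟨w, fun _ => ⟨hadj, ?_⟩⟩
      have h1 := G.dist_le p
      rw [Walk.length_cons] at hp
      have h2 : G.dist v u ≤ G.dist v w + G.dist w u := hc.dist_triangle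
      have h3 : G.dist v w = 1 := dist_eq_one_iff_adj.2 hadj
      rw [dist_comm (u := u) (v := w), dist_comm (u := u) (v := v)]
      omega
  choose π hπ using hpar
  -- This is where breadth-first search matters: every edge at `u` is a tree edge, so the leftover
  -- edges avoid `u`.
  have hroot : ∀ v, G.Adj u v → π v = u := by
    intro v hv
    have h1 := (hπ v hv.ne').2
    rw [dist_eq_one_iff_adj.2 hv] at h1
    exact (hc.dist_eq_zero_iff.1 (by omega : G.dist u (π v) = 0)).symm
  set T : Finset (Sym2 W) := (Finset.univ.filter fun v => v ≠ u).image fun v => s(v, π v) with hT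
  have hTc : T.card + 1 = Fintype.card W := by
    rw [hT, Finset.card_image_of_injOn, Finset.filter_ne',
      Finset.card_erase_of_mem (Finset.mem_univ _), Finset.card_univ]
    · have : 0 < Fintype.card W := Fintype.card_pos_iff.2 ⟨u⟩
      omega
    · intro v hv w hw hvw
      simp only [Finset.coe_filter, Finset.mem_univ, true_and, Set.mem_ofPred_eq] at hv hw
      have h1 := (hπ v hv).2
      have h2 := (hπ w hw).2
      simp only [Sym2.eq_iff] at hvw
      -- Two vertices cannot be each other's parent, as the distance to `u` drops along `π`.
      rcases hvw with ⟨h, -⟩ | ⟨h, h'⟩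
      · exact h
      · rw [h'] at h1
        rw [← h] at h2
        omega
  have hTs : T ⊆ G.edgeFinset := by
    intro e he
    simp only [hT, Finset.mem_image, Finset.mem_filter, Finset.mem_univ, true_and] at he
    obtain ⟨v, hv, rfl⟩ := he
    simpa using (hπ v hv).1
  have hcard : (G.edgeFinset \ T).card = 2 := by
    have h1 := Finset.card_sdiff_add_card_eq_card hTs
    rw [Nat.card_eq_fintype_card, ← edgeFinset_card] at hE
    omega
  obtain ⟨e₁, e₂, hne, he⟩ := Finset.card_eq_two.1 hcard
  induction e₁ using Sym2.ind with | _ p₁ q₁ =>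
  induction e₂ using Sym2.ind with | _ p₂ q₂ =>
  have hmem : ∀ a b, s(a, b) ∈ T ↔ (a ≠ u ∧ b = π a) ∨ (b ≠ u ∧ a = π b) := by
    intro a b
    simp only [hT, Finset.mem_image, Finset.mem_filter, Finset.mem_univ, true_and, Sym2.eq_iff]
    constructor
    · rintro ⟨v, hv, ⟨rfl, rfl⟩ | ⟨rfl, rfl⟩⟩
      exacts [Or.inl ⟨hv, rfl⟩, Or.inr ⟨hv, rfl⟩]
    · rintro (⟨h, rfl⟩ | ⟨h, rfl⟩)
      exacts [⟨a, h, Or.inl ⟨rfl, rfl⟩⟩, ⟨b, h, Or.inr ⟨rfl, rfl⟩⟩]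
  have hextra : ∀ a b, s(a, b) ∈ G.edgeFinset \ T → a ≠ u := by
    rintro a b hab rfl
    rw [Finset.mem_sdiff, mem_edgeFinset, mem_edgeSet, hmem] at hab
    exact hab.2 (Or.inr ⟨hab.1.ne', (hroot b hab.1).symm⟩)
  have hm₁ : s(p₁, q₁) ∈ G.edgeFinset \ T := by rw [he]; simp
  have hm₂ : s(p₂, q₂) ∈ G.edgeFinset \ T := by rw [he]; simp
  refine ⟨π, p₁, q₁, p₂, q₂, fun v hv => (hπ v hv).1.ne', ⟨hextra _ _ hm₁,
    hextra _ _ (by rw [Sym2.eq_swap]; exact hm₁), hextra _ _ hm₂,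
    hextra _ _ (by rw [Sym2.eq_swap]; exact hm₂)⟩, hne, ?_⟩
  intro a b
  have h1 : s(a, b) ∈ G.edgeFinset ↔ s(a, b) ∈ T ∨ s(a, b) ∈ G.edgeFinset \ T := by
    rw [Finset.mem_sdiff]
    constructor
    · intro h
      by_cases h' : s(a, b) ∈ T
      exacts [Or.inl h', Or.inr ⟨h, h'⟩]
    · rintro (h | h)
      exacts [hTs h, h.1]
  rw [mem_edgeFinset, mem_edgeSet, hmem, he] at h1
  rw [h1]
  simp only [Finset.mem_insert, Finset.mem_singleton, or_assoc]

/-- A connected graph with one more edge than vertices that has a sub-eigenvector of large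
eigenvalue is a star with two additional edges which share a vertex. -/
theorem isBook_of_large {W : Type*} [Fintype W] {G : SimpleGraph W} [DecidableRel G.Adj]
    (hc : G.Connected) (hE : Nat.card G.edgeSet = Fintype.card W + 1) {y : W → ℝ} {l : ℝ}
    (h0 : ∀ a, 0 ≤ y a) (hne : y ≠ 0) (hy : ∀ a, l * y a ≤ ∑ b, if G.Adj a b then y b else 0)
    (hl : 67 / 25 ≤ l)
    (hlarge : (Fintype.card W : ℝ) - 1 + (4 * l + 6) / (l ^ 2 - 2) ≤ l ^ 2) : G.IsBook := by
  classical
  obtain ⟨a, ha⟩ := Function.ne_iff.mp hne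
  have : Nonempty W := ⟨a⟩
  obtain ⟨u, hu⟩ := Finite.exists_max y
  have hpos : 0 < y u := lt_of_lt_of_le (lt_of_le_of_ne (h0 a) (Ne.symm ha)) (hu a)
  obtain ⟨π, p₁, q₁, p₂, q₂, hπ, ⟨n₁, n₂, n₃, n₄⟩, hdiff, hadj⟩ :=
    exists_tree_add_two_edges hc hE u
  have hz : IsTreeSubeigenvector u π p₁ q₁ p₂ q₂ (fun a => y a / y u) l := by
    refine ⟨fun a => div_nonneg (h0 a) hpos.le, fun a => (div_le_one hpos).2 (hu a),
      div_self hpos.ne', hπ, n₁, n₂, n₃, n₄, ?_, ?_, ?_⟩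
    · exact ((hadj p₁ q₁).2 (by simp)).ne
    · exact ((hadj p₂ q₂).2 (by simp)).ne
    · intro a
      have hedge : ∀ p q, ∑ b, (if s(a, b) = s(p, q) then y b else 0) ≤
          edgeContribution y p q a := by
        intro p q
        have : edgeContribution y p q a =
            ∑ b, ((if b = q then if a = p then y b else 0 else 0) +
              (if b = p then if a = q then y b else 0 else 0)) := by
          simp [edgeContribution, Finset.sum_add_distrib]
        rw [this]
        refine Finset.sum_le_sum fun b _ => ?_
        have := h0 b
        simp only [Sym2.eq_iff]
        grind
      have key : l * y a ≤ (if a = u then 0 else y (π a)) + ∑ b with b ≠ u ∧ π b = a, y b +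
          edgeContribution y p₁ q₁ a + edgeContribution y p₂ q₂ a := by
        have e1 : (if a = u then 0 else y (π a)) =
            ∑ b, if b = π a then if a = u then 0 else y b else 0 := by simp
        calc l * y a ≤ ∑ b, if G.Adj a b then y b else 0 := hy a
          _ ≤ ∑ b, ((if b = π a then if a = u then 0 else y b else 0) +
              (if b ≠ u ∧ π b = a then y b else 0) +
              (if s(a, b) = s(p₁, q₁) then y b else 0) +
              (if s(a, b) = s(p₂, q₂) then y b else 0)) := by
            refine Finset.sum_le_sum fun b _ => ?_
            have := h0 b
            rw [if_congr (hadj a b) rfl rfl]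
            grind
          _ ≤ _ := by
            rw [Finset.sum_add_distrib, Finset.sum_add_distrib, Finset.sum_add_distrib, ← e1,
              ← Finset.sum_filter]
            linarith [hedge p₁ q₁, hedge p₂ q₂]
      have hscale : ∀ p q, edgeContribution (fun a => y a / y u) p q a =
          edgeContribution y p q a / y u := by
        intro p q
        unfold edgeContribution
        split_ifs <;> simp [add_div]
      rw [hscale, hscale, ← Finset.sum_div]
      have e2 : (if a = u then 0 else y (π a) / y u) = (if a = u then 0 else y (π a)) / y u := by
        split_ifs <;> simp
      rw [e2, ← add_div, ← add_div, ← add_div, ← mul_div_assoc]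
      gcongr
  obtain ⟨hstar, c, p, q, hcu, hpu, hqu, hcp, hcq, hpq, e₁, e₂⟩ :=
    hz.eq_star_of_large hl hdiff hlarge
  refine ⟨u, c, p, q, ⟨hcu.symm, hpu.symm, hqu.symm, hcp, hcq, hpq⟩, fun x y => ?_⟩
  constructor
  · intro h
    refine ⟨h.ne, ?_⟩
    rcases (hadj x y).1 h with ⟨hx, hy⟩ | ⟨hx, hy⟩ | h | h
    · rw [hstar x hx] at hy
      exact Or.inr (Or.inl hy)
    · rw [hstar y hx] at hy
      exact Or.inl hy
    · exact Or.inr (Or.inr (Or.inl (h.trans e₁)))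
    · exact Or.inr (Or.inr (Or.inr (h.trans e₂)))
  · rintro ⟨hxy, rfl | rfl | h | h⟩
    · exact (hadj x y).2 (Or.inr (Or.inl ⟨hxy.symm, (hstar y hxy.symm).symm⟩))
    · exact (hadj x y).2 (Or.inl ⟨hxy, (hstar x hxy).symm⟩)
    · exact (hadj x y).2 (Or.inr (Or.inr (Or.inl (h.trans e₁.symm))))
    · exact (hadj x y).2 (Or.inr (Or.inr (Or.inr (h.trans e₂.symm))))

/-- The vector on the vertices of a book graph that is an eigenvector for its largest eigenvalue. -/
theorem IsBook.exists_eigenvector {W : Type*} [Fintype W] {G : SimpleGraph W} [DecidableRel G.Adj]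
    (hG : G.IsBook) {l : ℝ} (hl : 67 / 25 ≤ l)
    (heq : (Fintype.card W : ℝ) - 1 + (4 * l + 6) / (l ^ 2 - 2) = l ^ 2) :
    ∃ y : W → ℝ, (∀ a, 0 < y a) ∧ ∀ a, ∑ b, (if G.Adj a b then y b else 0) = l * y a := by
  classical
  obtain ⟨u, c, p, q, ⟨huc, hup, huq, hcp, hcq, hpq⟩, hadj⟩ := hG
  have hd : 0 < l ^ 2 - 2 := by nlinarith
  have hl0 : 0 < l := by linarith
  -- With value 1 at `u`, the values `C` at `c` and `P` at `p`, `q` solve `l * C = 1 + 2 * P` and `l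
  -- * P = 1 + C`; the leaves get `l⁻¹`. The equation at `u` is then `heq`, because `2 * (C + P) =
  -- (4 * l + 6) / (l ^ 2 - 2)`.
  set C := (l + 2) / (l ^ 2 - 2) with hC
  set P := (1 + C) / l with hP
  have hC0 : 0 < C := by positivity
  have hP0 : 0 < P := by positivity
  have hCl : l * C = 1 + 2 * P := by
    rw [hP, hC]; field_simp; ring
  have hPl : l * P = 1 + C := by
    rw [hP]; field_simp
  have hul : C + 2 * P + ((Fintype.card W : ℝ) - 4) / l = l := by
    have h1 : (Fintype.card W : ℝ) = l ^ 2 + 1 - (4 * l + 6) / (l ^ 2 - 2) := by linarith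
    rw [h1, hP, hC]; field_simp; ring
  set y : W → ℝ := fun b => l⁻¹ + (if b = u then 1 - l⁻¹ else 0) + (if b = c then C - l⁻¹ else 0) +
    (if b = p then P - l⁻¹ else 0) + (if b = q then P - l⁻¹ else 0) with hy
  have yu : y u = 1 := by simp [hy, huc, hup, huq]
  have yc : y c = C := by simp [hy, huc.symm, hcp, hcq]
  have yp : y p = P := by simp [hy, hup.symm, hcp.symm, hpq]
  have yq : y q = P := by simp [hy, huq.symm, hcq.symm, hpq.symm]
  have yo : ∀ a, a ≠ u → a ≠ c → a ≠ p → a ≠ q → y a = l⁻¹ := by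
    intro a h1 h2 h3 h4
    simp [hy, h1, h2, h3, h4]
  refine ⟨y, ?_, ?_⟩
  · intro a
    by_cases h1 : a = u
    · rw [h1, yu]; exact one_pos
    by_cases h2 : a = c
    · rw [h2, yc]; exact hC0
    by_cases h3 : a = p
    · rw [h3, yp]; exact hP0
    by_cases h4 : a = q
    · rw [h4, yq]; exact hP0
    rw [yo a h1 h2 h3 h4]
    positivity
  · intro a
    by_cases h1 : a = u
    · subst h1
      have : ∀ b, (if G.Adj a b then y b else 0) = y b - if b = a then 1 else 0 := by
        intro b
        rw [if_congr (hadj a b) rfl rfl]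
        by_cases hb : b = a
        · subst hb; simp [yu]
        · simp [hb, Ne.symm hb]
      rw [Finset.sum_congr rfl fun b _ => this b, Finset.sum_sub_distrib, yu]
      simp only [hy, Finset.sum_add_distrib, Finset.sum_ite_eq', Finset.mem_univ, if_true,
        Finset.sum_const, Finset.card_univ, nsmul_eq_mul]
      rw [div_eq_mul_inv] at hul
      linarith
    · have : ∀ b, (if G.Adj a b then y b else 0) = (if b = u then 1 else 0) +
          (if b = p then if a = c then P else 0 else 0) +
          (if b = q then if a = c then P else 0 else 0) +
          (if b = c then if a = p then C else 0 else 0) +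
          (if b = c then if a = q then C else 0 else 0) := by
        intro b
        rw [if_congr (hadj a b) rfl rfl]
        simp only [Sym2.eq_iff]
        grind
      rw [Finset.sum_congr rfl fun b _ => this b]
      simp only [Finset.sum_add_distrib, Finset.sum_ite_eq', Finset.mem_univ, if_true]
      by_cases h2 : a = c
      · subst h2; simp [yc, hcp, hcq]; linarith
      by_cases h3 : a = p
      · subst h3; simp [yp, h2, hpq]; linarith
      by_cases h4 : a = q
      · subst h4; simp [yq, h2, h3]; linarith
      simp [h2, h3, h4, yo a h1 h2 h3 h4, hl0.ne']

/-- The largest eigenvalue of a book graph on `n` vertices. -/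
theorem exists_book_eigenvalue {n : ℝ} (hn : 5 ≤ n) :
    ∃ l : ℝ, 67 / 25 ≤ l ∧ n - 1 + (4 * l + 6) / (l ^ 2 - 2) = l ^ 2 := by
  -- The cleared equation is negative at `67 / 25 = 2.68`, which lies just below its root 2.685...
  -- for `n = 5`, and nonnegative at `n + 1`.
  have hcont : ContinuousOn (fun l : ℝ => l ^ 2 * (l ^ 2 - 2) - (n - 1) * (l ^ 2 - 2) - (4 * l + 6))
      (Set.Icc (67 / 25) (n + 1)) := by fun_prop
  have h := intermediate_value_Icc (by linarith) hcont
  obtain ⟨l, hl, hl0⟩ := h (show (0 : ℝ) ∈ _ by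
    constructor
    · norm_num; linarith
    · have h1 : (0 : ℝ) ≤ (n - 5) := by linarith
      have : (0 : ℝ) ≤ (n - 5) ^ 2 := by positivity
      have : (0 : ℝ) ≤ (n - 5) ^ 3 := by positivity
      have : (0 : ℝ) ≤ (n - 5) ^ 4 := by positivity
      show (0 : ℝ) ≤ (n + 1) ^ 2 * ((n + 1) ^ 2 - 2) - (n - 1) * ((n + 1) ^ 2 - 2)
        - (4 * (n + 1) + 6)
      nlinarith)
  have hd : 0 < l ^ 2 - 2 := by nlinarith [hl.1]
  refine ⟨l, hl.1, ?_⟩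
  simp only at hl0
  field_simp
  linarith

/-- Every number above the largest eigenvalue of a book graph satisfies the bound on the
sub-eigenvalues. -/
theorem book_bound_of_le {n l r : ℝ} (hl : 67 / 25 ≤ l)
    (heq : n - 1 + (4 * l + 6) / (l ^ 2 - 2) = l ^ 2) (hr : l ≤ r) :
    n - 1 + (4 * r + 6) / (r ^ 2 - 2) ≤ r ^ 2 := by
  have h1 : l ^ 2 ≤ r ^ 2 := by gcongr
  have h2 : (4 * r + 6) / (r ^ 2 - 2) ≤ (4 * l + 6) / (l ^ 2 - 2) := by
    rw [div_le_div_iff₀ (by nlinarith) (by nlinarith)]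
    nlinarith [mul_nonneg (sub_nonneg.2 hr) (mul_nonneg (by linarith : 0 ≤ l)
      (by linarith : 0 ≤ r))]
  linarith

end SimpleGraph

/-! ### Isomorphic hypergraphs -/

namespace Hypergraph

universe u v w

variable {α : Type u} {β : Type v} {γ : Type w} {H : Hypergraph α} {K : Hypergraph β}
  {L : Hypergraph γ}

theorem Isomorphic.symm (h : H.Isomorphic K) : K.Isomorphic H := by
  obtain ⟨f, hf⟩ := h
  refine ⟨f.symm, fun s => ?_⟩
  rw [hf, Equiv.image_symm_eq_preimage, Set.image_preimage_eq _ f.surjective]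

theorem Isomorphic.trans (h : H.Isomorphic K) (h' : K.Isomorphic L) : H.Isomorphic L := by
  obtain ⟨f, hf⟩ := h
  obtain ⟨g, hg⟩ := h'
  refine ⟨f.trans g, fun s => ?_⟩
  rw [hf, hg, Equiv.coe_trans, Set.image_comp]

theorem isomorphic_of_injective (φ : α → β) (hφ : Function.Injective φ) (hV : V(K) = φ '' V(H))
    (hE : E(K) = (fun e => φ '' e) '' E(H)) : H.Isomorphic K := by
  refine ⟨(Equiv.Set.image φ V(H) hφ).trans (Equiv.setCongr hV.symm), fun s => ?_⟩
  have : Subtype.val '' (((Equiv.Set.image φ V(H) hφ).trans (Equiv.setCongr hV.symm)) '' s) =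
      φ '' (Subtype.val '' s) := by
    rw [Set.image_image, Set.image_image]
    rfl
  rw [this, hE, hφ.image_injective.mem_set_image]

theorem exists_image_val_eq {e : Set α} (he : e ∈ E(H)) : ∃ s : Set V(H), Subtype.val '' s = e :=
  ⟨Subtype.val ⁻¹' e, by
    rw [Subtype.image_preimage_coe, Set.inter_eq_right]; exact he.subset_vertexSet⟩

theorem ncard_edgeSet : E(H).ncard = {s : Set V(H) | Subtype.val '' s ∈ E(H)}.ncard := by
  rw [← Set.ncard_image_of_injective _ Subtype.val_injective.image_injective]
  congr 1
  ext e
  constructor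
  · intro he
    obtain ⟨s, rfl⟩ := exists_image_val_eq he
    exact ⟨s, he, rfl⟩
  · rintro ⟨s, hs, rfl⟩
    exact hs

theorem Isomorphic.ncard_edgeSet (h : H.Isomorphic K) : E(H).ncard = E(K).ncard := by
  obtain ⟨f, hf⟩ := h
  rw [Hypergraph.ncard_edgeSet, Hypergraph.ncard_edgeSet,
    ← Set.ncard_image_of_injective _ f.injective.image_injective]
  congr 1
  ext t
  constructor
  · rintro ⟨s, hs, rfl⟩
    exact (hf s).1 hs
  · intro ht
    refine ⟨f ⁻¹' t, ?_, Set.image_preimage_eq _ f.surjective⟩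
    rw [Set.mem_ofPred_eq, hf, Set.image_preimage_eq _ f.surjective]
    exact ht

theorem Isomorphic.ncard_vertexSet (h : H.Isomorphic K) : V(H).ncard = V(K).ncard := by
  obtain ⟨f, -⟩ := h
  exact Nat.card_congr f

theorem Isomorphic.finite (h : H.Isomorphic K) (hK : V(K).Finite) : V(H).Finite := by
  obtain ⟨f, -⟩ := h
  have : Finite V(K) := hK
  exact Finite.of_equiv _ f.symm

theorem Isomorphic.isUniform (h : H.Isomorphic K) {k : ℕ} (hK : K.IsUniform k) :
    H.IsUniform k := by
  obtain ⟨f, hf⟩ := h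
  intro e he
  obtain ⟨s, rfl⟩ := exists_image_val_eq he
  have := hK _ ((hf s).1 he)
  rwa [Set.ncard_image_of_injective _ Subtype.val_injective,
    Set.ncard_image_of_injective _ f.injective,
    ← Set.ncard_image_of_injective _ Subtype.val_injective] at this

theorem Isomorphic.isConnected (h : H.Isomorphic K) (hK : K.IsConnected) : H.IsConnected := by
  obtain ⟨f, hf⟩ := h.symm
  have hadj : ∀ x y (hx : x ∈ V(K)) (hy : y ∈ V(K)), K.Adj x y →
      H.Adj (f ⟨x, hx⟩) (f ⟨y, hy⟩) := by
    rintro x y hx hy ⟨e, he, hxe, hye⟩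
    obtain ⟨s, rfl⟩ := exists_image_val_eq he
    obtain ⟨x', hx', rfl⟩ := hxe
    obtain ⟨y', hy', rfl⟩ := hye
    exact ⟨_, (hf s).1 he, ⟨_, ⟨x', hx', rfl⟩, rfl⟩, ⟨_, ⟨y', hy', rfl⟩, rfl⟩⟩
  have hmem : ∀ x y, K.Adj x y → y ∈ V(K) := by
    rintro x y ⟨e, he, -, hy⟩
    exact he.subset_vertexSet hy
  have hwalk : ∀ x y (hx : x ∈ V(K)), Relation.ReflTransGen K.Adj x y →
      ∃ hy : y ∈ V(K), Relation.ReflTransGen H.Adj (f ⟨x, hx⟩ : α) (f ⟨y, hy⟩) := by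
    intro x y hx hxy
    induction hxy with
    | refl => exact ⟨hx, .refl⟩
    | tail _ h₂ ih =>
      obtain ⟨hb, hb'⟩ := ih
      exact ⟨hmem _ _ h₂, hb'.tail (hadj _ _ hb _ h₂)⟩
  refine ⟨?_, fun x hx y hy => ?_⟩
  · obtain ⟨x, hx⟩ := hK.1
    exact ⟨_, (f ⟨x, hx⟩).2⟩
  · obtain ⟨⟨x', hx'⟩, hxx⟩ := f.surjective ⟨x, hx⟩
    obtain ⟨⟨y', hy'⟩, hyy⟩ := f.surjective ⟨y, hy⟩
    obtain ⟨hy'', h'⟩ := hwalk x' y' hx' (hK.2 x' hx' y' hy')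
    rwa [hxx, hyy] at h'

theorem IsConnected.numComponents_eq_one (h : H.IsConnected) : H.numComponents = 1 := by
  rw [numComponents, Nat.card_eq_one_iff_unique]
  constructor
  · constructor
    intro a b
    induction a using Quotient.ind
    induction b using Quotient.ind
    exact Quotient.sound (h.2 _ (Subtype.prop _) _ (Subtype.prop _))
  · obtain ⟨x, hx⟩ := h.1
    exact ⟨Quotient.mk _ ⟨x, hx⟩⟩

/-! ### Powers of graphs -/

section Power

variable {W : Type*} {G : SimpleGraph W} {k : ℕ}

/-- The edge of the `k`-th power of `G` which comes from the edge `e` of `G`. -/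
def powerEdge (G : SimpleGraph W) (k : ℕ) (e : G.edgeSet) : Set (W ⊕ (G.edgeSet × Fin (k - 2))) :=
  Sum.inl '' {w : W | w ∈ (e : Sym2 W)} ∪ Sum.inr '' {p : G.edgeSet × Fin (k - 2) | p.1 = e}

theorem edgeSet_power : E(power G k) = Set.range (powerEdge G k) := rfl

theorem vertexSet_power : V(power G k) = Set.univ := rfl

@[simp]
theorem inl_mem_powerEdge {w : W} {e : G.edgeSet} :
    Sum.inl w ∈ powerEdge G k e ↔ w ∈ (e : Sym2 W) := by
  simp [powerEdge]

@[simp]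
theorem inr_mem_powerEdge {p : G.edgeSet × Fin (k - 2)} {e : G.edgeSet} :
    Sum.inr p ∈ powerEdge G k e ↔ p.1 = e := by
  simp [powerEdge]

theorem powerEdge_injective : Function.Injective (powerEdge G k) := by
  intro e e' h
  apply Subtype.ext
  refine Sym2.ext fun w => ?_
  rw [← inl_mem_powerEdge (k := k), h, inl_mem_powerEdge]

theorem ncard_edgeSet_power : E(power G k).ncard = Nat.card G.edgeSet := by
  rw [edgeSet_power, ← Set.image_univ, Set.ncard_image_of_injective _ powerEdge_injective,
    Set.ncard_univ]

theorem ncard_vertexSet_power [Finite W] :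
    V(power G k).ncard = Nat.card W + Nat.card G.edgeSet * (k - 2) := by
  rw [vertexSet_power, Set.ncard_univ, Nat.card_sum, Nat.card_prod, Nat.card_fin]

theorem isUniform_power [Finite W] (hk : 2 ≤ k) : (power G k).IsUniform k := by
  rintro _ ⟨e, rfl⟩
  change (powerEdge G k e).ncard = k
  rw [powerEdge, Set.ncard_union_eq, Set.ncard_image_of_injective _ Sum.inl_injective,
    Set.ncard_image_of_injective _ Sum.inr_injective]
  · have h1 : {w : W | w ∈ (e : Sym2 W)}.ncard = 2 := by
      obtain ⟨e, he⟩ := e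
      induction e using Sym2.ind with | _ a b =>
      have : {w : W | w ∈ s(a, b)} = {a, b} := by ext; simp
      rw [this, Set.ncard_pair (G.ne_of_adj he)]
    have h2 : {p : G.edgeSet × Fin (k - 2) | p.1 = e}.ncard = k - 2 := by
      have : {p : G.edgeSet × Fin (k - 2) | p.1 = e} = Set.range fun j => (e, j) := by
        ext ⟨e', j⟩
        simp [eq_comm]
      rw [this, ← Set.image_univ, Set.ncard_image_of_injective, Set.ncard_univ, Nat.card_fin]
      intro a b hab
      simpa using hab
    omega
  · rw [Set.disjoint_left]
    rintro _ ⟨a, -, rfl⟩ ⟨b, -, hb⟩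
    cases hb

theorem connected_of_isConnected_power (h : (power G k).IsConnected) : G.Connected := by
  -- An added vertex is represented by both ends of its edge, so a walk in the power projects to
  -- reachability in `G`.
  let rep : W ⊕ (G.edgeSet × Fin (k - 2)) → Set W := Sum.elim (fun w => {w}) fun p => {w | w ∈ p.1.1}
  have hedge : ∀ e : G.edgeSet, ∀ a ∈ e.1, ∀ b ∈ e.1, G.Reachable a b := by
    rintro ⟨e, he⟩ a ha b hb
    by_cases hab : a = b
    · rw [hab]
    · have : e = s(a, b) := (Sym2.mem_and_mem_iff hab).1 ⟨ha, hb⟩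
      subst this
      exact SimpleGraph.Adj.reachable he
  have hne : ∀ x, ∃ a, a ∈ rep x := by
    rintro (w | ⟨⟨e, he⟩, j⟩)
    · exact ⟨w, rfl⟩
    · exact ⟨_, Sym2.out_fst_mem e⟩
  have hrep : ∀ x e, x ∈ powerEdge G k e → ∀ a ∈ rep x, a ∈ e.1 := by
    rintro (w | p) e hx a ha
    · rw [inl_mem_powerEdge] at hx
      rw [show a = w from ha]
      exact hx
    · rw [inr_mem_powerEdge] at hx
      rw [← hx]
      exact ha
  have hwalk : ∀ w y, Relation.ReflTransGen (power G k).Adj (Sum.inl w) y →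
      ∀ b ∈ rep y, G.Reachable w b := by
    intro w y hy
    induction hy with
    | refl => rintro b rfl; rfl
    | @tail y z _ h₂ ih =>
      intro b hb
      obtain ⟨a, ha⟩ := hne y
      obtain ⟨_, ⟨e, rfl⟩, hy, hz⟩ := h₂
      exact (ih a ha).trans (hedge e a (hrep _ e hy a ha) b (hrep _ e hz b hb))
  rw [SimpleGraph.connected_iff]
  constructor
  · intro a b
    exact hwalk a (Sum.inl b) (h.2 _ (Set.mem_univ _) _ (Set.mem_univ _)) b rfl
  · obtain ⟨x, -⟩ := h.1
    exact ⟨(hne x).choose⟩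

theorem isConnected_power (h : G.Connected) : (power G k).IsConnected := by
  have hadj : ∀ a b, G.Adj a b → (power G k).Adj (Sum.inl a) (Sum.inl b) := fun a b hab =>
    ⟨_, ⟨⟨s(a, b), hab⟩, rfl⟩, inl_mem_powerEdge.2 (by simp), inl_mem_powerEdge.2 (by simp)⟩
  have hwalk : ∀ a b, Relation.ReflTransGen (power G k).Adj (Sum.inl a) (Sum.inl b) := by
    intro a b
    obtain ⟨p⟩ := h.preconnected a b
    induction p with
    | nil => rfl
    | cons hab _ ih => exact .head (hadj _ _ hab) ih
  have hrep : ∀ x, ∃ a, (power G k).Adj x (Sum.inl a) ∨ x = Sum.inl a := by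
    rintro (w | p)
    · exact ⟨w, Or.inr rfl⟩
    · exact ⟨_, Or.inl ⟨_, ⟨p.1, rfl⟩, inr_mem_powerEdge.2 rfl,
        inl_mem_powerEdge.2 (Sym2.out_fst_mem p.1.1)⟩⟩
  refine ⟨?_, fun x _ y _ => ?_⟩
  · obtain ⟨a⟩ := h.nonempty
    exact ⟨Sum.inl a, Set.mem_univ _⟩
  · obtain ⟨a, ha⟩ := hrep x
    obtain ⟨b, hb⟩ := hrep y
    have h1 : Relation.ReflTransGen (power G k).Adj x (Sum.inl a) := by
      rcases ha with ha | rfl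
      exacts [.single ha, .refl]
    have h2 : Relation.ReflTransGen (power G k).Adj (Sum.inl b) y := by
      rcases hb with hb | rfl
      exacts [.single hb.symm, .refl]
    exact (h1.trans (hwalk a b)).trans h2

/-- A hypergraph whose edges are indexed by the edges of `G`, where every edge consists of the two
ends of the corresponding edge of `G` and `k - 2` vertices of its own, is the `k`-th power
of `G`. -/
theorem isomorphic_power_of_indexed {I : Type*} (f : W → α) (g : I × Fin (k - 2) → α)
    (ends : I → Sym2 W) (hends : Function.Injective ends) (hrange : Set.range ends = G.edgeSet)
    (hfg : Function.Injective (Sum.elim f g)) (hV : V(H) = Set.range (Sum.elim f g))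
    (hE : E(H) = Set.range fun i => f '' {w | w ∈ ends i} ∪ g '' {p | p.1 = i}) :
    H.Isomorphic (power G k) := by
  let σ : I ≃ G.edgeSet := (Equiv.ofInjective ends hends).trans (Equiv.setCongr hrange)
  have hσ : ∀ i, (σ i : Sym2 W) = ends i := fun i => rfl
  let τ : W ⊕ (G.edgeSet × Fin (k - 2)) ≃ W ⊕ (I × Fin (k - 2)) :=
    Equiv.sumCongr (Equiv.refl W) (Equiv.prodCongr σ.symm (Equiv.refl _))
  refine (isomorphic_of_injective (Sum.elim f g ∘ τ) (hfg.comp τ.injective) ?_ ?_).symm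
  · rw [hV, vertexSet_power, Set.image_univ, EquivLike.range_comp]
  · rw [hE, edgeSet_power, ← Set.range_comp, ← σ.surjective.range_comp]
    congr 1
    funext i
    simp only [Function.comp_apply, powerEdge, Set.image_union, Set.image_image, hσ]
    congr 1
    ext a
    simp only [Set.mem_image, Set.mem_ofPred_eq, Prod.exists]
    constructor
    · rintro ⟨i', j, rfl, rfl⟩
      exact ⟨σ i', j, rfl, by simp [τ]⟩
    · rintro ⟨e, j, rfl, rfl⟩
      exact ⟨i, j, rfl, by simp [τ]⟩

theorem isomorphic_power_power {W' : Type*} {G' : SimpleGraph W'} (φ : G ≃g G') :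
    (power G k).Isomorphic (power G' k) := by
  refine isomorphic_power_of_indexed (fun w => Sum.inl (φ.symm w)) Sum.inr
    (fun e : G.edgeSet => Sym2.map φ e.1) ?_ ?_ ?_ ?_ ?_
  · intro e e' h
    exact Subtype.ext (Sym2.map.injective φ.injective h)
  · ext e
    induction e using Sym2.ind with | _ a b =>
    constructor
    · rintro ⟨⟨e', he'⟩, h⟩
      simp only at h
      rw [← h]
      induction e' using Sym2.ind with | _ c d =>
      exact φ.map_adj_iff.2 he'
    · intro hab
      exact ⟨⟨s(φ.symm a, φ.symm b), φ.symm.map_adj_iff.2 hab⟩, by simp⟩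
  · rintro (a | a) (b | b) h <;> simp_all
  · rw [vertexSet_power, eq_comm, Set.range_eq_univ]
    rintro (a | a)
    · exact ⟨Sum.inl (φ a), by simp⟩
    · exact ⟨Sum.inr a, rfl⟩
  · rw [edgeSet_power]
    congr 1
    funext e
    rw [powerEdge]
    congr 1
    ext x
    simp only [Set.mem_image, Set.mem_ofPred_eq, Sym2.mem_map]
    constructor
    · rintro ⟨w, hw, rfl⟩
      exact ⟨φ w, ⟨w, hw, rfl⟩, by simp⟩
    · rintro ⟨_, ⟨w, hw, rfl⟩, rfl⟩
      exact ⟨w, hw, by simp⟩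

/-- The graph whose power is a bicyclic hypergraph is connected and has one edge more than it has
vertices. -/
theorem graph_of_isPowerBicyclic {m : ℕ} (h : H.IsPowerBicyclic k m) (hk : 3 ≤ k)
    (hG : H.Isomorphic (power G k)) :
    Finite W ∧ G.Connected ∧ Nat.card G.edgeSet = m ∧ m = Nat.card W + 1 := by
  have hfin : Finite (W ⊕ (G.edgeSet × Fin (k - 2))) :=
    Set.finite_univ_iff.1 (hG.symm.finite h.finite)
  have hW : Finite W := Finite.of_injective (Sum.inl : W → W ⊕ (G.edgeSet × Fin (k - 2)))
    Sum.inl_injective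
  have h1 := hG.ncard_vertexSet
  have h2 := hG.ncard_edgeSet
  rw [ncard_vertexSet_power] at h1
  rw [ncard_edgeSet_power, h.card_edges] at h2
  have h3 := h.bicyclic.2
  rw [cyclomaticNumber, h.bicyclic.1.numComponents_eq_one, h1, h.card_edges, ← h2] at h3
  refine ⟨hW, connected_of_isConnected_power (hG.symm.isConnected h.bicyclic.1), h2.symm, ?_⟩
  -- The vertex count `n + m * (k - 2)` turns the cyclomatic number into `m - n + 1`, whatever `k`
  -- is.
  zify
  push_cast [Nat.cast_sub (show 2 ≤ k by omega)] at h3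
  linarith

theorem isPowerBicyclic_of_graph [Finite W] (hk : 3 ≤ k) (hG : H.Isomorphic (power G k))
    (hp : H.IsPower k) (hc : G.Connected) (hE : Nat.card G.edgeSet = Nat.card W + 1) :
    H.IsPowerBicyclic k (Nat.card W + 1) := by
  have h1 := hG.ncard_vertexSet
  have h2 := hG.ncard_edgeSet
  rw [ncard_vertexSet_power] at h1
  rw [ncard_edgeSet_power, hE] at h2
  have hc' := hG.isConnected (isConnected_power hc)
  refine ⟨hG.finite (Set.toFinite _), hG.isUniform (isUniform_power (by omega)), hp,
    ⟨hc', ?_⟩, h2⟩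
  rw [cyclomaticNumber, hc'.numComponents_eq_one, h1, h2, hE]
  push_cast [Nat.cast_sub (show 2 ≤ k by omega)]
  ring

end Power

end Hypergraph

/-! ### Eigenvalues of powers of graphs -/

section Counting

-- A map from `Fin d` with an image of size `d` is a bijection onto it. This is the count that the
-- factor `1 / (k - 1)!` in the tensor cancels.
open scoped Classical in
theorem card_filter_image_eq {V : Type*} [Fintype V] {d : ℕ} {R : Finset V} (hR : R.card = d) :
    (Finset.univ.filter fun F : Fin d → V => Finset.univ.image F = R).card = d.factorial := by
  have h1 : Fintype.card (Fin d ≃ R) = d.factorial := by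
    rw [Fintype.card_equiv (Fintype.equivOfCardEq (by simp [hR])), Fintype.card_fin]
  rw [← h1, ← Finset.card_univ]
  symm
  refine Finset.card_bij (fun e _ => fun j => (e j : V)) ?_ ?_ ?_
  · intro e _
    simp only [Finset.mem_filter, Finset.mem_univ, true_and]
    ext v
    simp only [Finset.mem_image, Finset.mem_univ, true_and]
    constructor
    · rintro ⟨j, rfl⟩
      exact (e j).2
    · intro hv
      exact ⟨e.symm ⟨v, hv⟩, by simp⟩
  · intro e _ e' _ h
    ext j
    exact congrFun h j
  · intro F hF
    simp only [Finset.mem_filter, Finset.mem_univ, true_and] at hF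
    have hmem : ∀ j, F j ∈ R := fun j => hF ▸ Finset.mem_image_of_mem F (Finset.mem_univ j)
    have hbij : Function.Bijective fun j => (⟨F j, hmem j⟩ : R) := by
      rw [Fintype.bijective_iff_surjective_and_card]
      refine ⟨?_, by simp [hR]⟩
      rintro ⟨v, hv⟩
      rw [← hF, Finset.mem_image] at hv
      obtain ⟨j, -, rfl⟩ := hv
      exact ⟨j, rfl⟩
    exact ⟨Equiv.ofBijective _ hbij, Finset.mem_univ _, rfl⟩

open scoped Classical in
theorem sum_insert_range_eq {V : Type*} [Fintype V] {d : ℕ} {S : Finset V} (hS : S.card = d + 1)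
    (a : V) (x : V → ℂ) :
    ∑ F : Fin d → V, (if (S : Set V) = insert a (Set.range F) then
      1 / (d.factorial : ℂ) * ∏ j, x (F j) else 0) =
      if a ∈ S then ∏ b ∈ S.erase a, x b else 0 := by
  have hiff : ∀ F : Fin d → V, (S : Set V) = insert a (Set.range F) ↔
      S = insert a (Finset.univ.image F) := by
    intro F
    rw [← Finset.coe_inj]
    simp
  simp only [hiff]
  split_ifs with ha
  · have hR : (S.erase a).card = d := by rw [Finset.card_erase_of_mem ha, hS]; rfl
    have hiff' : ∀ F : Fin d → V, S = insert a (Finset.univ.image F) ↔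
        Finset.univ.image F = S.erase a := by
      intro F
      constructor
      · intro h
        symm
        refine Finset.eq_of_subset_of_card_le ?_ ?_
        · rw [h]
          exact Finset.erase_insert_subset _ _
        · rw [hR]
          exact Finset.card_image_le.trans (by simp)
      · intro h
        rw [h, Finset.insert_erase ha]
    simp only [hiff']
    rw [← Finset.sum_filter, Finset.sum_congr rfl (g := fun _ =>
      1 / (d.factorial : ℂ) * ∏ b ∈ S.erase a, x b), Finset.sum_const, card_filter_image_eq hR,
      nsmul_eq_mul, ← mul_assoc, mul_one_div_cancel, one_mul]
    · exact_mod_cast d.factorial_ne_zero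
    · intro F hF
      rw [Finset.mem_filter] at hF
      rw [← hF.2, Finset.prod_image]
      refine Finset.card_image_iff.1 ?_
      rw [hF.2, hR, Finset.card_univ, Fintype.card_fin]
  · refine Finset.sum_eq_zero fun F _ => if_neg ?_
    rintro rfl
    exact ha (Finset.mem_insert_self _ _)

end Counting

namespace Hypergraph

open scoped Classical

variable {α W : Type*} {H : Hypergraph α} {G : SimpleGraph W} {k : ℕ}

/-- The vertices of an edge of the power of a finite graph. -/
noncomputable def powerEdgeFinset [Fintype W] [Fintype G.edgeSet] (k : ℕ) (e : G.edgeSet) :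
    Finset (W ⊕ (G.edgeSet × Fin (k - 2))) :=
  Finset.univ.filter (· ∈ powerEdge G k e)

section

variable [Fintype W] [Fintype G.edgeSet]

@[simp]
theorem coe_powerEdgeFinset (e : G.edgeSet) :
    (powerEdgeFinset k e : Set (W ⊕ (G.edgeSet × Fin (k - 2)))) = powerEdge G k e := by
  ext
  simp [powerEdgeFinset]

@[simp]
theorem inl_mem_powerEdgeFinset {w : W} {e : G.edgeSet} :
    Sum.inl w ∈ powerEdgeFinset k e ↔ w ∈ (e : Sym2 W) := by
  simp [powerEdgeFinset]

@[simp]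
theorem inr_mem_powerEdgeFinset {p : G.edgeSet × Fin (k - 2)} {e : G.edgeSet} :
    Sum.inr p ∈ powerEdgeFinset k e ↔ p.1 = e := by
  simp [powerEdgeFinset]

theorem card_powerEdgeFinset (hk : 2 ≤ k) (e : G.edgeSet) : (powerEdgeFinset k e).card = k := by
  rw [← Set.ncard_coe_finset, coe_powerEdgeFinset]
  exact isUniform_power hk _ ⟨e, rfl⟩

theorem prod_powerEdgeFinset {R : Type*} [CommMonoid R] (x : W ⊕ (G.edgeSet × Fin (k - 2)) → R)
    {a b : W} (hab : G.Adj a b) :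
    ∏ v ∈ powerEdgeFinset k ⟨s(a, b), hab⟩, x v =
      x (Sum.inl a) * x (Sum.inl b) * ∏ j, x (Sum.inr (⟨s(a, b), hab⟩, j)) := by
  rw [powerEdgeFinset, Finset.prod_filter, Fintype.prod_sum_type, Fintype.prod_prod_type]
  simp only [inl_mem_powerEdge, inr_mem_powerEdge]
  congr 1
  · rw [← Finset.prod_filter]
    have : (Finset.univ.filter fun w => w ∈ s(a, b)) = {a, b} := by ext; simp
    rw [this, Finset.prod_pair hab.ne]
  · rw [Finset.prod_eq_single (⟨s(a, b), hab⟩ : G.edgeSet)]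
    · simp
    · intro e _ he
      simp [he]
    · simp

theorem sum_incident {R : Type*} [AddCommMonoid R] (h : Sym2 W → R) (a : W) :
    ∑ e : G.edgeSet, (if a ∈ (e : Sym2 W) then h e else 0) =
      ∑ b, if G.Adj a b then h s(a, b) else 0 := by
  rw [← Finset.sum_filter, ← Finset.sum_filter]
  symm
  refine Finset.sum_bij (fun b hb => ⟨s(a, b), (Finset.mem_filter.1 hb).2⟩) ?_ ?_ ?_ ?_
  · intro b _
    simp
  · intro b _ c _ hbc
    exact Sym2.congr_right.1 (congrArg Subtype.val hbc)
  · rintro ⟨e, he⟩ hae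
    simp only [Finset.mem_filter, Finset.mem_univ, true_and] at hae
    obtain ⟨b, rfl⟩ := hae
    exact ⟨b, by simpa using he, rfl⟩
  · intros
    rfl

/-- Each tuple whose range is an edge is assigned to that edge, unique because `powerEdge` is
injective. After exchanging the sums, `sum_insert_range_eq` evaluates the part of each edge. -/
theorem mulVec_adjacencyTensor [Fintype V(H)] (hk : 3 ≤ k)
    (φ : V(H) ≃ W ⊕ (G.edgeSet × Fin (k - 2)))
    (hφ : ∀ s : Set V(H), Subtype.val '' s ∈ E(H) ↔ ∃ e, powerEdge G k e = φ '' s)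
    (x : W ⊕ (G.edgeSet × Fin (k - 2)) → ℂ) (i : V(H)) :
    HypTensor.mulVec (H.adjacencyTensor k) (fun v => x (φ v)) i =
      ∑ e : G.edgeSet, if φ i ∈ powerEdgeFinset k e then
        ∏ b ∈ (powerEdgeFinset k e).erase (φ i), x b else 0 := by
  have hterm : ∀ F : Fin (k - 1) → V(H),
      (H.adjacencyTensor k (Fin.cons i F) : ℂ) * ∏ j, x (φ (F j)) =
      ∑ e : G.edgeSet, if (powerEdgeFinset k e : Set (W ⊕ (G.edgeSet × Fin (k - 2)))) =
        insert (φ i) (Set.range fun j => φ (F j)) then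
          1 / ((k - 1).factorial : ℂ) * ∏ j, x (φ (F j)) else 0 := by
    intro F
    have h1 : Set.range (fun j => ((Fin.cons i F : Fin (k - 1 + 1) → V(H)) j : α)) =
        Subtype.val '' (insert i (Set.range F)) := by
      rw [← Fin.range_cons, ← Set.range_comp]
      rfl
    have h2 : φ '' (insert i (Set.range F)) = insert (φ i) (Set.range fun j => φ (F j)) := by
      rw [Set.image_insert_eq, ← Set.range_comp]
      rfl
    rw [adjacencyTensor, h1]
    simp only [hφ, h2, coe_powerEdgeFinset]
    by_cases h : ∃ e, powerEdge G k e = insert (φ i) (Set.range fun j => φ (F j))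
    · rw [if_pos h]
      obtain ⟨e₀, he₀⟩ := h
      simp only [← he₀, powerEdge_injective.eq_iff, Finset.sum_ite_eq', Finset.mem_univ, if_true]
      push_cast
      rfl
    · rw [if_neg h]
      push Not at h
      simp [h]
  rw [HypTensor.mulVec, Finset.sum_congr rfl fun F _ => hterm F, Finset.sum_comm]
  refine Finset.sum_congr rfl fun e _ => ?_
  have key := sum_insert_range_eq (d := k - 1) (S := powerEdgeFinset k e)
    (by rw [card_powerEdgeFinset (by omega)]; omega) (φ i) x
  refine (Fintype.sum_equiv ((Equiv.refl (Fin (k - 1))).arrowCongr φ) _ _ fun F => rfl).trans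
    (key.trans ?_)
  congr
  exact Subsingleton.elim _ _

theorem isEigenvalue_adjacencyTensor_iff [Fintype V(H)] (hk : 3 ≤ k)
    (h : H.Isomorphic (power G k)) (μ : ℂ) :
    HypTensor.IsEigenvalue (H.adjacencyTensor k) μ ↔
      ∃ x : W ⊕ (G.edgeSet × Fin (k - 2)) → ℂ, x ≠ 0 ∧ ∀ a,
        (∑ e : G.edgeSet, if a ∈ powerEdgeFinset k e then
          ∏ b ∈ (powerEdgeFinset k e).erase a, x b else 0) = μ * x a ^ (k - 1) := by
  obtain ⟨f, hf⟩ := h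
  let φ : V(H) ≃ W ⊕ (G.edgeSet × Fin (k - 2)) := f.trans (Equiv.Set.univ _)
  have hφ : ∀ s : Set V(H), Subtype.val '' s ∈ E(H) ↔ ∃ e, powerEdge G k e = φ '' s := by
    intro s
    rw [hf, edgeSet_power, Set.mem_range]
    have : Subtype.val '' (f '' s) = φ '' s := by
      rw [Set.image_image]
      rfl
    rw [this]
  constructor
  · rintro ⟨x, hx, hμ⟩
    refine ⟨fun a => x (φ.symm a), ?_, fun a => ?_⟩
    · intro h0
      refine hx (funext fun v => ?_)
      have := congrFun h0 (φ v)
      simpa using this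
    · have := mulVec_adjacencyTensor hk φ hφ (fun a => x (φ.symm a)) (φ.symm a)
      simp only [Equiv.symm_apply_apply, Equiv.apply_symm_apply] at this
      rw [← this]
      exact hμ _
  · rintro ⟨x, hx, hμ⟩
    refine ⟨fun v => x (φ v), ?_, fun i => ?_⟩
    · intro h0
      refine hx (funext fun a => ?_)
      have := congrFun h0 (φ.symm a)
      simpa using this
    · rw [mulVec_adjacencyTensor hk φ hφ]
      exact hμ _

/-- An eigenvector of the power of a graph yields a sub-eigenvector of the graph. -/
theorem exists_subeigenvector (hk : 3 ≤ k) {μ : ℂ} (hμ : μ ≠ 0)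
    {x : W ⊕ (G.edgeSet × Fin (k - 2)) → ℂ} (hx : x ≠ 0)
    (heig : ∀ a, (∑ e : G.edgeSet, if a ∈ powerEdgeFinset k e then
      ∏ b ∈ (powerEdgeFinset k e).erase a, x b else 0) = μ * x a ^ (k - 1)) :
    ∃ y : W → ℝ, (∀ a, 0 ≤ y a) ∧ y ≠ 0 ∧
      ∀ a, √(‖μ‖ ^ k) * y a ≤ ∑ b, if G.Adj a b then y b else 0 := by
  have hstar : ∀ a, (∑ e : G.edgeSet, if a ∈ powerEdgeFinset k e then
      ∏ b ∈ powerEdgeFinset k e, x b else 0) = μ * x a ^ k := by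
    intro a
    have h1 : x a ^ k = x a * x a ^ (k - 1) := by
      rw [← pow_succ', show k - 1 + 1 = k by omega]
    rw [h1, mul_left_comm, ← heig, Finset.mul_sum]
    refine Finset.sum_congr rfl fun e _ => ?_
    split_ifs with h
    · rw [Finset.mul_prod_erase _ _ h]
    · simp
  -- A vertex added to `e` lies in no other edge, so its equation has a single term.
  have hcore : ∀ (e : G.edgeSet) j, ∏ b ∈ powerEdgeFinset k e, x b = μ * x (Sum.inr (e, j)) ^ k := by
    intro e j
    rw [← hstar]
    simp
  have hμ0 : 0 < ‖μ‖ := norm_pos_iff.2 hμ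
  set y : W → ℝ := fun a => √(‖x (Sum.inl a)‖ ^ k) with hy
  have hy0 : ∀ a, 0 ≤ y a := fun a => Real.sqrt_nonneg _
  have hysq : ∀ a, y a * y a = ‖x (Sum.inl a)‖ ^ k := fun a => Real.mul_self_sqrt (by positivity)
  -- With M the norm of the edge product, the added vertices satisfy `‖x‖ ^ k = M / ‖μ‖`. Hence `M ^
  -- k = (‖x a‖ * ‖x b‖) ^ k * (M / ‖μ‖) ^ (k - 2)`, and cancelling `M ^ (k - 2)` leaves `M ^ 2 *
  -- ‖μ‖ ^ (k - 2) = (y a * y b) ^ 2`.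
  have hbound : ∀ a b (hab : G.Adj a b),
      ‖∏ v ∈ powerEdgeFinset k ⟨s(a, b), hab⟩, x v‖ * √(‖μ‖ ^ (k - 2)) ≤ y a * y b := by
    intro a b hab
    have hM := congrArg norm (prod_powerEdgeFinset x hab)
    rw [norm_mul, norm_mul, norm_prod Finset.univ] at hM
    set M := ‖∏ v ∈ powerEdgeFinset k ⟨s(a, b), hab⟩, x v‖ with hMdef
    have hM0 : 0 ≤ M := norm_nonneg _
    have hj : ∀ j, ‖x (Sum.inr (⟨s(a, b), hab⟩, j))‖ ^ k = M / ‖μ‖ := by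
      intro j
      rw [hMdef, hcore _ j, norm_mul, norm_pow, mul_div_cancel_left₀ _ hμ0.ne']
    rcases hM0.eq_or_lt with h0 | hpos
    · rw [← h0, zero_mul]
      exact mul_nonneg (hy0 a) (hy0 b)
    · have h1 : M ^ k = (‖x (Sum.inl a)‖ * ‖x (Sum.inl b)‖) ^ k * (M / ‖μ‖) ^ (k - 2) := by
        conv_lhs => rw [hM]
        rw [mul_pow, ← Finset.prod_pow, Finset.prod_congr rfl fun j _ => hj j]
        simp [div_pow]
      have h2 : M ^ 2 * ‖μ‖ ^ (k - 2) = (‖x (Sum.inl a)‖ * ‖x (Sum.inl b)‖) ^ k := by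
        have h3 : M ^ k = M ^ 2 * M ^ (k - 2) := by
          rw [← pow_add]
          congr 1
          omega
        rw [h3, div_pow] at h1
        have h4 : M ^ (k - 2) ≠ 0 := by positivity
        have h5 : ‖μ‖ ^ (k - 2) ≠ 0 := by positivity
        field_simp at h1
        linarith
      have h3 : y a * y b = √(M ^ 2 * ‖μ‖ ^ (k - 2)) := by
        rw [h2, mul_pow, Real.sqrt_mul (by positivity)]
      rw [h3, Real.sqrt_mul (by positivity), Real.sqrt_sq hM0]
  refine ⟨y, hy0, ?_, ?_⟩
  · intro h0
    have hx0 : ∀ a, x (Sum.inl a) = 0 := by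
      intro a
      have h1 := hysq a
      rw [h0] at h1
      simp only [Pi.zero_apply, mul_zero] at h1
      exact norm_eq_zero.1 (pow_eq_zero_iff (by omega) |>.1 h1.symm)
    -- If `x` vanishes on the vertices of `G`, all edge products vanish, and `μ ≠ 0` forces the
    -- added vertices to vanish too.
    refine hx (funext ?_)
    rintro (a | ⟨⟨e, he⟩, j⟩)
    · exact hx0 a
    · induction e using Sym2.ind with | _ a b =>
      have h1 := hcore ⟨s(a, b), he⟩ j
      rw [prod_powerEdgeFinset x he, hx0 a, zero_mul, zero_mul] at h1
      have h2 := (mul_eq_zero.1 h1.symm).resolve_left hμ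
      exact pow_eq_zero_iff (by omega) |>.1 h2
  · intro a
    have h1 : √(‖μ‖ ^ k) = ‖μ‖ * √(‖μ‖ ^ (k - 2)) := by
      rw [show ‖μ‖ ^ k = ‖μ‖ ^ 2 * ‖μ‖ ^ (k - 2) by
        rw [← pow_add]; congr 1; omega, Real.sqrt_mul (by positivity), Real.sqrt_sq hμ0.le]
    have h2 : √(‖μ‖ ^ k) * (y a * y a) ≤ y a * ∑ b, if G.Adj a b then y b else 0 := by
      calc √(‖μ‖ ^ k) * (y a * y a) = ‖μ * x (Sum.inl a) ^ k‖ * √(‖μ‖ ^ (k - 2)) := by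
            rw [h1, hysq, norm_mul, norm_pow]; ring
        _ = ‖∑ b, if h : G.Adj a b then ∏ v ∈ powerEdgeFinset k ⟨s(a, b), h⟩, x v else 0‖
              * √(‖μ‖ ^ (k - 2)) := by
            rw [← hstar]
            have := sum_incident (G := G) (fun e => if h : e ∈ G.edgeSet then
              ∏ v ∈ powerEdgeFinset k ⟨e, h⟩, x v else 0) a
            congr 2
            convert this using 1
            · refine Finset.sum_congr rfl fun e _ => ?_
              simp
            · refine Finset.sum_congr rfl fun b _ => ?_
              by_cases hab : G.Adj a b <;> simp [hab]
        _ ≤ (∑ b, if h : G.Adj a b then ‖∏ v ∈ powerEdgeFinset k ⟨s(a, b), h⟩, x v‖ else 0)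
              * √(‖μ‖ ^ (k - 2)) := by
            gcongr
            refine (norm_sum_le _ _).trans (Finset.sum_le_sum fun b _ => ?_)
            split_ifs <;> simp
        _ ≤ y a * ∑ b, if G.Adj a b then y b else 0 := by
            rw [Finset.sum_mul, Finset.mul_sum]
            refine Finset.sum_le_sum fun b _ => ?_
            split_ifs with h
            · exact hbound a b h
            · simp
    rcases (hy0 a).eq_or_lt with h0 | hpos
    · rw [← h0, mul_zero]
      refine Finset.sum_nonneg fun b _ => ?_
      split_ifs
      exacts [hy0 b, le_rfl]
    · refine le_of_mul_le_mul_left ?_ hpos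
      linarith

/-- A positive eigenvector of a graph yields an eigenvector of its powers. -/
theorem exists_eigenvector_power (hk : 3 ≤ k) {y : W → ℝ} {l r : ℝ} (hl : 0 < l) (hr : 0 < r)
    (hrl : r ^ k = l ^ 2) (hy : ∀ a, 0 < y a) [Nonempty W]
    (heig : ∀ a, ∑ b, (if G.Adj a b then y b else 0) = l * y a) :
    ∃ x : W ⊕ (G.edgeSet × Fin (k - 2)) → ℂ, x ≠ 0 ∧ ∀ a,
      (∑ e : G.edgeSet, if a ∈ powerEdgeFinset k e then
        ∏ b ∈ (powerEdgeFinset k e).erase a, x b else 0) = r * x a ^ (k - 1) := by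
  set Z : Sym2 W → ℝ := fun e => ∏ w ∈ Finset.univ.filter (· ∈ e), y w with hZ
  have hZ0 : ∀ e, 0 < Z e := fun e => Finset.prod_pos fun w _ => hy w
  have hZab : ∀ a b, G.Adj a b → Z s(a, b) = y a * y b := by
    intro a b hab
    have : (Finset.univ.filter fun w => w ∈ s(a, b)) = {a, b} := by ext; simp
    rw [hZ]
    simp only [this, Finset.prod_pair hab.ne]
  -- This inverts the elimination in `exists_subeigenvector`: `x ^ k` is `y a ^ 2` at `a` and `y a *
  -- y b / l` at the vertices added to `{a, b}`. By `r ^ k = l ^ 2`, the product over that edge is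
  -- `r * y a * y b / l`.
  set x : W ⊕ (G.edgeSet × Fin (k - 2)) → ℝ :=
    Sum.elim (fun a => (y a ^ 2) ^ ((k : ℝ)⁻¹)) (fun p => (Z p.1 / l) ^ ((k : ℝ)⁻¹)) with hx
  have hk0 : k ≠ 0 := by omega
  have hx0 : ∀ v, 0 < x v := by
    rintro (a | p)
    · exact Real.rpow_pos_of_pos (pow_pos (hy a) 2) _
    · exact Real.rpow_pos_of_pos (div_pos (hZ0 _) hl) _
  have hxl : ∀ a, x (Sum.inl a) ^ k = y a ^ 2 := fun a =>
    Real.rpow_inv_natCast_pow (by positivity) hk0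
  have hxr : ∀ p, x (Sum.inr p) ^ k = Z p.1 / l := fun p =>
    Real.rpow_inv_natCast_pow (div_pos (hZ0 _) hl).le hk0
  have hM : ∀ e : G.edgeSet, ∏ b ∈ powerEdgeFinset k e, x b = r * Z e / l := by
    rintro ⟨e, he⟩
    induction e using Sym2.ind with | _ a b =>
    have hZp := hZ0 s(a, b)
    refine (pow_left_inj₀ (Finset.prod_nonneg fun v _ => (hx0 v).le) (by positivity) hk0).1 ?_
    rw [prod_powerEdgeFinset x he, mul_pow, mul_pow, hxl, hxl, ← Finset.prod_pow,
      Finset.prod_congr rfl fun j _ => hxr _]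
    simp only [Finset.prod_const, Finset.card_univ, Fintype.card_fin]
    rw [← mul_pow, ← hZab a b he, div_pow, div_pow, mul_pow, hrl]
    have h3 : ∀ t : ℝ, t ^ k = t ^ 2 * t ^ (k - 2) := by
      intro t
      rw [← pow_add]
      congr 1
      omega
    rw [h3 (Z _), h3 l]
    field_simp
  have hstar : ∀ a, (∑ e : G.edgeSet, if a ∈ powerEdgeFinset k e then
      ∏ b ∈ powerEdgeFinset k e, x b else 0) = r * x a ^ k := by
    simp only [hM]
    rintro (a | ⟨e, j⟩)
    · simp only [inl_mem_powerEdgeFinset]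
      rw [sum_incident (fun e => r * Z e / l), hxl]
      have : ∀ b, (if G.Adj a b then r * Z s(a, b) / l else 0) =
          r * y a / l * if G.Adj a b then y b else 0 := by
        intro b
        split_ifs with hab
        · rw [hZab a b hab]; ring
        · simp
      rw [Finset.sum_congr rfl fun b _ => this b, ← Finset.mul_sum, heig]
      field_simp
    · rw [hxr]
      simp [mul_div_assoc]
  have hreal : ∀ a, (∑ e : G.edgeSet, if a ∈ powerEdgeFinset k e then
      ∏ b ∈ (powerEdgeFinset k e).erase a, x b else 0) = r * x a ^ (k - 1) := by
    intro a
    refine mul_left_cancel₀ (hx0 a).ne' ?_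
    have h1 : x a ^ k = x a * x a ^ (k - 1) := by
      rw [← pow_succ', show k - 1 + 1 = k by omega]
    rw [mul_left_comm, ← h1, ← hstar, Finset.mul_sum]
    refine Finset.sum_congr rfl fun e _ => ?_
    split_ifs with h
    · rw [Finset.mul_prod_erase _ _ h]
    · simp
  refine ⟨fun v => (x v : ℂ), ?_, fun a => ?_⟩
  · intro h0
    obtain ⟨a⟩ := ‹Nonempty W›
    have := congrFun h0 (Sum.inl a)
    simp only [Pi.zero_apply, Complex.ofReal_eq_zero] at this
    exact (hx0 _).ne' this
  · have := congrArg (fun t : ℝ => (t : ℂ)) (hreal a)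
    push_cast at this
    refine Eq.trans (Finset.sum_congr rfl fun e _ => ?_) this
    split_ifs <;> simp

end

end Hypergraph

/-! ### Book graphs -/

namespace SimpleGraph

/-- Adjacency in a book depends only on the four named vertices, so any bijection matching them is
an isomorphism. -/
theorem IsBook.iso {W W' : Type*} [Finite W] [Finite W'] {G : SimpleGraph W} {G' : SimpleGraph W'}
    (hG : G.IsBook) (hG' : G'.IsBook) (hcard : Nat.card W = Nat.card W') : Nonempty (G ≃g G') := by
  classical
  have := Fintype.ofFinite W
  have := Fintype.ofFinite W'
  obtain ⟨u, c, p, q, ⟨huc, hup, huq, hcp, hcq, hpq⟩, hadj⟩ := hG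
  obtain ⟨u', c', p', q', ⟨huc', hup', huq', hcp', hcq', hpq'⟩, hadj'⟩ := hG'
  let f : W → W' := fun x => if x = u then u' else if x = c then c' else if x = p then p' else q'
  have fu : f u = u' := by simp [f]
  have fc : f c = c' := by simp [f, huc.symm]
  have fp : f p = p' := by simp [f, hup.symm, hcp.symm]
  have fq : f q = q' := by simp [f, huq.symm, hcq.symm, hpq.symm]
  have hinj : Set.InjOn f (({u, c, p, q} : Finset W) : Set W) := by
    intro x hx y hy hxy
    simp only [Finset.coe_insert, Finset.coe_singleton, Set.mem_insert_iff,
      Set.mem_singleton_iff] at hx hy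
    rcases hx with rfl | rfl | rfl | rfl <;> rcases hy with rfl | rfl | rfl | rfl <;>
      simp_all [eq_comm]
  rw [Nat.card_eq_fintype_card, Nat.card_eq_fintype_card, ← Finset.card_univ (α := W')] at hcard
  obtain ⟨g, hg⟩ := Finset.exists_equiv_extend_of_card_eq hcard (Finset.subset_univ _) hinj
  let φ : W ≃ W' := g.trans (Equiv.subtypeUnivEquiv Finset.mem_univ)
  have hφ : ∀ x ∈ ({u, c, p, q} : Finset W), φ x = f x := hg
  have φu : φ u = u' := (hφ u (by simp)).trans fu
  have φc : φ c = c' := (hφ c (by simp)).trans fc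
  have φp : φ p = p' := (hφ p (by simp)).trans fp
  have φq : φ q = q' := (hφ q (by simp)).trans fq
  refine ⟨φ, ?_⟩
  intro x y
  rw [hadj, hadj', ← φu, ← φc, ← φp, ← φq]
  simp only [ne_eq, EmbeddingLike.apply_eq_iff_eq, Sym2.eq_iff]

theorem IsBook.connected {W : Type*} {G : SimpleGraph W} (hG : G.IsBook) : G.Connected := by
  obtain ⟨u, c, p, q, -, hadj⟩ := hG
  have hu : ∀ x, G.Reachable u x := by
    intro x
    by_cases hx : u = x
    · rw [hx]
    · exact ((hadj u x).2 ⟨hx, Or.inl rfl⟩).reachable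
  rw [connected_iff]
  exact ⟨fun x y => (hu x).symm.trans (hu y), ⟨u⟩⟩

/-- The star with center `u` and the two additional edges `{c, p}` and `{c, q}`. -/
def bookGraph {W : Type*} (u c p q : W) : SimpleGraph W where
  Adj x y := x ≠ y ∧ (x = u ∨ y = u ∨ s(x, y) = s(c, p) ∨ s(x, y) = s(c, q))
  symm := ⟨fun x y h => by
    rw [Sym2.eq_swap (a := y)]
    exact ⟨h.1.symm, by tauto⟩⟩
  loopless := ⟨fun x h => h.1 rfl⟩

theorem bookGraph_adj {W : Type*} {u c p q x y : W} : (bookGraph u c p q).Adj x y ↔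
    x ≠ y ∧ (x = u ∨ y = u ∨ s(x, y) = s(c, p) ∨ s(x, y) = s(c, q)) := Iff.rfl

end SimpleGraph

/-! ### The theta graph with pendant edges -/

namespace Hypergraph

theorem edgeSet_thetaGraph : thetaGraph.edgeSet =
    (({s(0, 1), s(0, 2), s(1, 2), s(0, 3), s(1, 3)} : Finset (Sym2 (Fin 4))) :
      Set (Sym2 (Fin 4))) := by
  rw [thetaGraph, SimpleGraph.edgeSet_fromEdgeSet]
  ext e
  simp only [Set.mem_sdiff, Set.mem_insert_iff, Set.mem_singleton_iff, Finset.coe_insert,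
    Finset.coe_singleton, Sym2.mem_diagSet]
  constructor
  · exact fun h => h.1
  · intro h
    refine ⟨h, ?_⟩
    rcases h with rfl | rfl | rfl | rfl | rfl <;> simp

theorem card_edgeSet_thetaGraph : Nat.card thetaGraph.edgeSet = 5 := by
  rw [edgeSet_thetaGraph, Nat.card_coe_set_eq, Set.ncard_coe_finset]
  decide

theorem card_edgeSet_starGraph (r : ℕ) :
    Nat.card (SimpleGraph.starGraph (0 : Fin (r + 1))).edgeSet = r := by
  have h : (SimpleGraph.starGraph (0 : Fin (r + 1))).edgeSet =
      Set.range fun j : Fin r => s(0, j.succ) := by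
    ext e
    induction e using Sym2.ind with | _ a b =>
    rw [SimpleGraph.mem_edgeSet, SimpleGraph.starGraph_adj]
    constructor
    · rintro ⟨hab, rfl | rfl⟩
      · obtain ⟨j, rfl⟩ := Fin.exists_succ_eq.2 hab.symm
        exact ⟨j, rfl⟩
      · obtain ⟨j, rfl⟩ := Fin.exists_succ_eq.2 hab
        exact ⟨j, Sym2.eq_swap⟩
    · rintro ⟨j, hj⟩
      rw [Sym2.eq_iff] at hj
      rcases hj with ⟨rfl, rfl⟩ | ⟨rfl, rfl⟩
      · exact ⟨(Fin.succ_ne_zero _).symm, Or.inl rfl⟩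
      · exact ⟨Fin.succ_ne_zero _, Or.inr rfl⟩
  rw [h, Nat.card_coe_set_eq, ← Set.image_univ, Set.ncard_image_of_injective, Set.ncard_univ,
    Nat.card_fin]
  intro i j hij
  exact Fin.succ_injective _ (Sym2.congr_right.1 hij)

theorem degree_power_inl {W : Type*} {G : SimpleGraph W} {k : ℕ} (w : W) :
    (power G k).degree (Sum.inl w) = {e | e ∈ G.edgeSet ∧ w ∈ e}.ncard := by
  have h1 : {e | e ∈ E(power G k) ∧ Sum.inl w ∈ e} =
      powerEdge G k '' {e | w ∈ (e : Sym2 W)} := by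
    ext e
    constructor
    · rintro ⟨⟨e, rfl⟩, he⟩
      exact ⟨e, inl_mem_powerEdge.1 he, rfl⟩
    · rintro ⟨e, he, rfl⟩
      exact ⟨⟨e, rfl⟩, inl_mem_powerEdge.2 he⟩
  have h2 : {e | e ∈ G.edgeSet ∧ w ∈ e} = Subtype.val '' {e : G.edgeSet | w ∈ (e : Sym2 W)} := by
    ext e
    simp [and_comm]
  rw [degree, h1, h2, Set.ncard_image_of_injective _ powerEdge_injective,
    Set.ncard_image_of_injective _ Subtype.val_injective]

theorem degree_power_inr {W : Type*} {G : SimpleGraph W} {k : ℕ} (p : G.edgeSet × Fin (k - 2)) :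
    (power G k).degree (Sum.inr p) = 1 := by
  have h1 : {e | e ∈ E(power G k) ∧ Sum.inr p ∈ e} = {powerEdge G k p.1} := by
    ext e
    constructor
    · rintro ⟨⟨e, rfl⟩, he⟩
      rw [inr_mem_powerEdge.1 he]
      rfl
    · rintro rfl
      exact ⟨⟨p.1, rfl⟩, inr_mem_powerEdge.2 rfl⟩
  rw [degree, h1, Set.ncard_singleton]

theorem degree_thetaPower_inl (k : ℕ) (w : Fin 4) :
    (thetaPower k).degree (Sum.inl w) = if w = 0 ∨ w = 1 then 3 else 2 := by
  have : {e | e ∈ thetaGraph.edgeSet ∧ w ∈ e} =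
      ((({s(0, 1), s(0, 2), s(1, 2), s(0, 3), s(1, 3)} : Finset (Sym2 (Fin 4))).filter
        fun e => w ∈ e : Finset (Sym2 (Fin 4))) : Set (Sym2 (Fin 4))) := by
    rw [edgeSet_thetaGraph]
    ext e
    simp only [Finset.mem_coe, Finset.mem_filter, Set.mem_ofPred_eq]
  rw [thetaPower, degree_power_inl, this, Set.ncard_coe_finset]
  clear this
  revert w
  decide

theorem eq_of_degree_thetaPower {k : ℕ} {v : Fin 4 ⊕ (thetaGraph.edgeSet × Fin (k - 2))}
    (hv : (thetaPower k).degree v = 3) : v = Sum.inl 0 ∨ v = Sum.inl 1 := by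
  rcases v with w | p
  · rw [degree_thetaPower_inl] at hv
    split_ifs at hv with h
    · exact h.imp (congrArg _) (congrArg _)
    · omega
  · rw [thetaPower, degree_power_inr] at hv
    omega

/-! ### The coalescence as the power of a book graph -/

section Coalescence

variable {r : ℕ} {a b : Fin 4}

/-- The ends of the edges of the theta graph with `r` pendant edges at the vertex `a`. -/
def thetaStarEnds (r : ℕ) (a : Fin 4) :
    thetaGraph.edgeSet ⊕ (SimpleGraph.starGraph (0 : Fin (r + 1))).edgeSet →
      Sym2 (Fin 4 ⊕ Fin r) :=
  Sum.elim (fun e => Sym2.map Sum.inl e.1)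
    (fun e => Sym2.map (Fin.cons (Sum.inl a) Sum.inr : Fin (r + 1) → Fin 4 ⊕ Fin r) e.1)

theorem cons_inl_inr_injective (a : Fin 4) :
    Function.Injective (Fin.cons (Sum.inl a) Sum.inr : Fin (r + 1) → Fin 4 ⊕ Fin r) := by
  rw [Fin.cons_injective_iff]
  exact ⟨by simp, Sum.inr_injective⟩

theorem thetaStarEnds_injective : Function.Injective (thetaStarEnds r a) := by
  have hne : ∀ (e : thetaGraph.edgeSet)
      (e' : (SimpleGraph.starGraph (0 : Fin (r + 1))).edgeSet),
      thetaStarEnds r a (Sum.inl e) ≠ thetaStarEnds r a (Sum.inr e') := by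
    rintro e ⟨e', he'⟩ h
    -- Every star edge has an end other than the center, and this end is not a vertex of the theta
    -- graph.
    have hj : ∃ j : Fin r, j.succ ∈ e' := by
      induction e' using Sym2.ind with | _ x y =>
      rw [SimpleGraph.mem_edgeSet, SimpleGraph.starGraph_adj] at he'
      by_cases hx : x = 0
      · subst hx
        obtain ⟨j, rfl⟩ := Fin.exists_succ_eq.2 he'.1.symm
        exact ⟨j, by simp⟩
      · obtain ⟨j, rfl⟩ := Fin.exists_succ_eq.2 hx
        exact ⟨j, by simp⟩
    obtain ⟨j, hj⟩ := hj
    have h1 : Sum.inr j ∈ thetaStarEnds r a (Sum.inr ⟨e', he'⟩) :=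
      Sym2.mem_map.2 ⟨j.succ, hj, by simp⟩
    rw [← h] at h1
    obtain ⟨w, -, hw⟩ := Sym2.mem_map.1 h1
    cases hw
  rintro (e | e) (e' | e') h
  · exact congrArg _ (Subtype.ext (Sym2.map.injective Sum.inl_injective h))
  · exact absurd h (hne _ _)
  · exact absurd h.symm (hne _ _)
  · exact congrArg _ (Subtype.ext (Sym2.map.injective (cons_inl_inr_injective a) h))

theorem range_thetaStarEnds (hab : a = 0 ∧ b = 1 ∨ a = 1 ∧ b = 0) :
    Set.range (thetaStarEnds r a) =
      (SimpleGraph.bookGraph (Sum.inl a : Fin 4 ⊕ Fin r) (Sum.inl b) (Sum.inl 2)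
        (Sum.inl 3)).edgeSet := by
  have hθ : ∀ i j, s(i, j) ∈ thetaGraph.edgeSet ↔
      i ≠ j ∧ (i = a ∨ j = a ∨ s(i, j) = s(b, 2) ∨ s(i, j) = s(b, 3)) := by
    intro i j
    rw [edgeSet_thetaGraph, Finset.mem_coe]
    rcases hab with ⟨rfl, rfl⟩ | ⟨rfl, rfl⟩ <;> revert i j <;> decide
  have hstar : ∀ x, x ≠ Sum.inl a → s(Sum.inl a, x) ∈ Set.range (thetaStarEnds r a) := by
    rintro (j | j) hx
    · have hj : j ≠ a := fun h => hx (congrArg _ h)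
      exact ⟨Sum.inl ⟨s(a, j), (hθ a j).2 ⟨hj.symm, Or.inl rfl⟩⟩, rfl⟩
    · exact ⟨Sum.inr ⟨s(0, j.succ), by simp [SimpleGraph.starGraph_adj, (Fin.succ_ne_zero j).symm]⟩,
        rfl⟩
  ext e
  induction e using Sym2.ind with | _ x y =>
  rw [SimpleGraph.mem_edgeSet, SimpleGraph.bookGraph_adj]
  constructor
  · rintro ⟨⟨e, he⟩ | ⟨e, he⟩, h⟩
    · induction e using Sym2.ind with | _ i j =>
      have h' : s((Sum.inl i : Fin 4 ⊕ Fin r), Sum.inl j) = s(x, y) := h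
      rw [hθ] at he
      rw [Sym2.eq_iff] at h'
      simp only [Sym2.eq_iff] at he ⊢
      rcases h' with ⟨rfl, rfl⟩ | ⟨rfl, rfl⟩ <;> simp only [ne_eq, Sum.inl.injEq] <;> tauto
    · induction e using Sym2.ind with | _ i j =>
      have h' : s((Fin.cons (Sum.inl a) Sum.inr : Fin (r + 1) → Fin 4 ⊕ Fin r) i,
        (Fin.cons (Sum.inl a) Sum.inr : Fin (r + 1) → Fin 4 ⊕ Fin r) j) = s(x, y) := h
      rw [SimpleGraph.mem_edgeSet, SimpleGraph.starGraph_adj] at he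
      have hne := (cons_inl_inr_injective (r := r) a).ne he.1
      rw [Sym2.eq_iff] at h'
      rcases he.2 with rfl | rfl
      · rw [Fin.cons_zero] at h' hne
        rcases h' with ⟨rfl, rfl⟩ | ⟨rfl, rfl⟩
        exacts [⟨hne, Or.inl rfl⟩, ⟨hne.symm, Or.inr (Or.inl rfl)⟩]
      · rw [Fin.cons_zero] at h' hne
        rcases h' with ⟨rfl, rfl⟩ | ⟨rfl, rfl⟩
        exacts [⟨hne, Or.inr (Or.inl rfl)⟩, ⟨hne.symm, Or.inl rfl⟩]
  · have hb2 : b ≠ 2 := by rcases hab with ⟨rfl, rfl⟩ | ⟨rfl, rfl⟩ <;> decide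
    have hb3 : b ≠ 3 := by rcases hab with ⟨rfl, rfl⟩ | ⟨rfl, rfl⟩ <;> decide
    rintro ⟨hxy, rfl | rfl | h | h⟩
    · exact hstar y hxy.symm
    · rw [Sym2.eq_swap]
      exact hstar x hxy
    · rw [h]
      exact ⟨Sum.inl ⟨s(b, 2), (hθ b 2).2 ⟨hb2, by simp⟩⟩, rfl⟩
    · rw [h]
      exact ⟨Sum.inl ⟨s(b, 3), (hθ b 3).2 ⟨hb3, by simp⟩⟩, rfl⟩

theorem isBook_thetaStar (hab : a = 0 ∧ b = 1 ∨ a = 1 ∧ b = 0) :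
    (SimpleGraph.bookGraph (Sum.inl a : Fin 4 ⊕ Fin r) (Sum.inl b) (Sum.inl 2)
      (Sum.inl 3)).IsBook := by
  refine ⟨_, _, _, _, ?_, fun x y => SimpleGraph.bookGraph_adj⟩
  rcases hab with ⟨rfl, rfl⟩ | ⟨rfl, rfl⟩ <;> simp [Sum.inl.injEq]

theorem card_edgeSet_thetaStar (hab : a = 0 ∧ b = 1 ∨ a = 1 ∧ b = 0) :
    Nat.card (SimpleGraph.bookGraph (Sum.inl a : Fin 4 ⊕ Fin r) (Sum.inl b) (Sum.inl 2)
      (Sum.inl 3)).edgeSet = 5 + r := by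
  rw [← range_thetaStarEnds hab, ← Nat.card_congr (Equiv.ofInjective _ thetaStarEnds_injective),
    Nat.card_sum, card_edgeSet_thetaGraph, card_edgeSet_starGraph]

/-- Gluing centers commutes with taking powers: the edges on both sides are indexed by the theta and
star edges together, as `isomorphic_power_of_indexed` requires. The vertices 0 and 1 can both serve
as the star center, the other one becoming the common vertex of the two extra edges. -/
theorem coalescence_isomorphic_power (k : ℕ) (hab : a = 0 ∧ b = 1 ∨ a = 1 ∧ b = 0) :
    (coalescence (thetaPower k) (Sum.inl a) (hyperstar k r) (Sum.inl 0)).Isomorphic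
      (power (SimpleGraph.bookGraph (Sum.inl a : Fin 4 ⊕ Fin r) (Sum.inl b) (Sum.inl 2)
        (Sum.inl 3)) k) := by
  let ι₁ : Fin 4 ⊕ (thetaGraph.edgeSet × Fin (k - 2)) →
      (Fin 4 ⊕ (thetaGraph.edgeSet × Fin (k - 2))) ⊕ (Fin (r + 1) ⊕
        ((SimpleGraph.starGraph (0 : Fin (r + 1))).edgeSet × Fin (k - 2))) := Sum.inl
  let ι₂ : Fin (r + 1) ⊕ ((SimpleGraph.starGraph (0 : Fin (r + 1))).edgeSet × Fin (k - 2)) →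
      (Fin 4 ⊕ (thetaGraph.edgeSet × Fin (k - 2))) ⊕ (Fin (r + 1) ⊕
        ((SimpleGraph.starGraph (0 : Fin (r + 1))).edgeSet × Fin (k - 2))) := fun w =>
    @ite _ (w = Sum.inl 0) (Classical.propDecidable _) (Sum.inl (Sum.inl a)) (Sum.inr w)
  let f : Fin 4 ⊕ Fin r →
      (Fin 4 ⊕ (thetaGraph.edgeSet × Fin (k - 2))) ⊕ (Fin (r + 1) ⊕
        ((SimpleGraph.starGraph (0 : Fin (r + 1))).edgeSet × Fin (k - 2))) :=
    Sum.elim (fun i => Sum.inl (Sum.inl i)) (fun j => Sum.inr (Sum.inl j.succ))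
  let g : (thetaGraph.edgeSet ⊕ (SimpleGraph.starGraph (0 : Fin (r + 1))).edgeSet) ×
        Fin (k - 2) →
      (Fin 4 ⊕ (thetaGraph.edgeSet × Fin (k - 2))) ⊕ (Fin (r + 1) ⊕
        ((SimpleGraph.starGraph (0 : Fin (r + 1))).edgeSet × Fin (k - 2))) := fun p =>
    Sum.elim (fun e => Sum.inl (Sum.inr (e, p.2))) (fun e => Sum.inr (Sum.inr (e, p.2))) p.1
  have hV : V(coalescence (thetaPower k) (Sum.inl a) (hyperstar k r) (Sum.inl 0)) =
      ι₁ '' Set.univ ∪ ι₂ '' Set.univ := rfl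
  have hE : E(coalescence (thetaPower k) (Sum.inl a) (hyperstar k r) (Sum.inl 0)) =
      (fun e => ι₁ '' e) '' Set.range (powerEdge thetaGraph k) ∪
      (fun e => ι₂ '' e) '' Set.range (powerEdge (SimpleGraph.starGraph (0 : Fin (r + 1))) k) :=
    rfl
  have hι₂l : ∀ j, ι₂ (Sum.inl j) =
      f ((Fin.cons (Sum.inl a) Sum.inr : Fin (r + 1) → Fin 4 ⊕ Fin r) j) := by
    intro j
    refine Fin.cases ?_ (fun j => ?_) j
    · simp [ι₂, f]
    · simp [ι₂, f]
  have hι₂r : ∀ e j, ι₂ (Sum.inr (e, j)) = g (Sum.inr e, j) := by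
    intro e j
    simp [ι₂, g]
  refine isomorphic_power_of_indexed f g (thetaStarEnds r a) thetaStarEnds_injective
    (range_thetaStarEnds hab) ?_ ?_ ?_
  · rintro ((i | i) | ⟨e | e, i⟩) ((j | j) | ⟨e' | e', j⟩) h <;>
      simp [f, g] at h ⊢ <;> exact h
  · rw [hV]
    ext x
    simp only [Set.image_univ, Set.mem_union, Set.mem_range]
    constructor
    · rintro (⟨i | ⟨e, j⟩, rfl⟩ | ⟨i | ⟨e, j⟩, rfl⟩)
      · exact ⟨Sum.inl (Sum.inl i), rfl⟩
      · exact ⟨Sum.inr (Sum.inl e, j), rfl⟩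
      · exact ⟨Sum.inl _, (hι₂l i).symm⟩
      · exact ⟨Sum.inr (Sum.inr e, j), (hι₂r e j).symm⟩
    · rintro ⟨(i | i) | ⟨e | e, j⟩, rfl⟩
      · exact Or.inl ⟨Sum.inl i, rfl⟩
      · exact Or.inr ⟨Sum.inl i.succ, hι₂l _⟩
      · exact Or.inl ⟨Sum.inr (e, j), rfl⟩
      · exact Or.inr ⟨Sum.inr (e, j), hι₂r _ _⟩
  · rw [hE, ← Set.range_comp, ← Set.range_comp, ← Set.Sum.elim_range]
    congr 1
    funext e
    rcases e with e | e
    · simp only [Sum.elim_inl, Function.comp_apply, powerEdge, Set.image_union, Set.image_image]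
      congr 1
      · ext x
        simp only [Set.mem_image, Set.mem_ofPred_eq, thetaStarEnds, Sum.elim_inl, Sym2.mem_map]
        constructor
        · rintro ⟨w, hw, rfl⟩
          exact ⟨Sum.inl w, ⟨w, hw, rfl⟩, rfl⟩
        · rintro ⟨_, ⟨w, hw, rfl⟩, rfl⟩
          exact ⟨w, hw, rfl⟩
      · ext x
        simp only [Set.mem_image, Set.mem_ofPred_eq, Prod.exists]
        constructor
        · rintro ⟨_, j, rfl, rfl⟩
          exact ⟨_, j, rfl, rfl⟩
        · rintro ⟨_, j, rfl, rfl⟩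
          exact ⟨_, j, rfl, rfl⟩
    · simp only [Sum.elim_inr, Function.comp_apply, powerEdge, Set.image_union, Set.image_image]
      congr 1
      · ext x
        simp only [Set.mem_image, Set.mem_ofPred_eq, thetaStarEnds, Sum.elim_inr, Sym2.mem_map]
        constructor
        · rintro ⟨w, hw, rfl⟩
          exact ⟨_, ⟨w, hw, rfl⟩, (hι₂l w).symm⟩
        · rintro ⟨_, ⟨w, hw, rfl⟩, rfl⟩
          exact ⟨w, hw, hι₂l w⟩
      · ext x
        simp only [Set.mem_image, Set.mem_ofPred_eq, Prod.exists]
        constructor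
        · rintro ⟨_, j, rfl, rfl⟩
          exact ⟨_, j, rfl, (hι₂r _ _).symm⟩
        · rintro ⟨_, j, rfl, rfl⟩
          exact ⟨_, j, rfl, hι₂r _ _⟩

end Coalescence

/-! ### Comparison of the spectral radii -/

theorem spectralRadius_eq_of_isomorphic_power {α β W : Type*} {H : Hypergraph α}
    {K : Hypergraph β} {G : SimpleGraph W} [Finite V(H)] [Finite V(K)] [Finite W] {k : ℕ}
    (hk : 3 ≤ k) (hH : H.Isomorphic (power G k)) (hK : K.Isomorphic (power G k)) :
    H.spectralRadius k = K.spectralRadius k := by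
  have := Fintype.ofFinite W
  have := Fintype.ofFinite G.edgeSet
  let := Fintype.ofFinite V(H)
  let := Fintype.ofFinite V(K)
  simp only [spectralRadius, HypTensor.spectralRadius, isEigenvalue_adjacencyTensor_iff hk hH,
    isEigenvalue_adjacencyTensor_iff hk hK]

theorem spectralRadius_lt_of_isBook {α β W W' : Type*} {H : Hypergraph α}
    {K : Hypergraph β} {G : SimpleGraph W} {G' : SimpleGraph W'} [Finite V(H)] [Finite V(K)]
    [Finite W] [Finite W'] {k : ℕ} (hk : 3 ≤ k) (hH : H.Isomorphic (power G k))
    (hK : K.Isomorphic (power G' k)) (hc : G.Connected)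
    (hE : Nat.card G.edgeSet = Nat.card W + 1) (hG : ¬ G.IsBook) (hG' : G'.IsBook)
    (hcard : Nat.card W = Nat.card W') (hW : 5 ≤ Nat.card W) :
    H.spectralRadius k < K.spectralRadius k := by
  classical
  have := Fintype.ofFinite W
  have := Fintype.ofFinite W'
  have := Fintype.ofFinite G.edgeSet
  have := Fintype.ofFinite G'.edgeSet
  rw [Nat.card_eq_fintype_card (α := W)] at hE hcard hW
  rw [Nat.card_eq_fintype_card (α := W')] at hcard
  have : Nonempty W' := Fintype.card_pos_iff.1 (by omega)
  obtain ⟨l, hl, hleq⟩ := SimpleGraph.exists_book_eigenvalue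
    (n := (Fintype.card W : ℝ)) (by exact_mod_cast hW)
  have hl0 : 0 < l := by linarith
  have hleq' := hleq
  rw [hcard] at hleq'
  obtain ⟨y, hy0, hy⟩ := hG'.exists_eigenvector hl hleq'
  have hk0 : k ≠ 0 := by omega
  -- The number `r = l ^ (2 / k)` separates the radii: it is an eigenvalue of `K`, and every
  -- eigenvalue of `H` has smaller modulus.
  obtain ⟨r, hr, hrl⟩ : ∃ r : ℝ, 0 < r ∧ r ^ k = l ^ 2 :=
    ⟨(l ^ 2) ^ ((k : ℝ)⁻¹), Real.rpow_pos_of_pos (by positivity) _,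
      Real.rpow_inv_natCast_pow (by positivity) hk0⟩
  let : Fintype V(H) := Fintype.ofFinite V(H)
  let : Fintype V(K) := Fintype.ofFinite V(K)
  have hrK : r ≤ K.spectralRadius k := by
    refine le_csSup ⟨∑ g, |K.adjacencyTensor k g|, ?_⟩ ⟨(r : ℂ), ?_, ?_⟩
    · rintro _ ⟨μ, hμ, rfl⟩
      exact HypTensor.norm_le_of_isEigenvalue _ hμ
    · rw [isEigenvalue_adjacencyTensor_iff hk hK]
      exact exists_eigenvector_power hk hl0 hr hrl hy0 hy
    · rw [Complex.norm_real, Real.norm_of_nonneg hr.le]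
  have hlt : ∀ μ, HypTensor.IsEigenvalue (H.adjacencyTensor k) μ → ‖μ‖ < r := by
    intro μ hμ
    by_contra! hcon
    rw [isEigenvalue_adjacencyTensor_iff hk hH] at hμ
    obtain ⟨x, hx, heig⟩ := hμ
    obtain ⟨z, hz0, hz, hsub⟩ :=
      exists_subeigenvector hk (norm_pos_iff.1 (hr.trans_le hcon)) hx heig
    have hle : l ≤ √(‖μ‖ ^ k) := by
      refine Real.le_sqrt_of_sq_le ?_
      rw [← hrl]
      gcongr
    exact hG (SimpleGraph.isBook_of_large hc hE hz0 hz hsub (hl.trans hle)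
      (SimpleGraph.book_bound_of_le hl hleq hle))
  refine lt_of_lt_of_le ?_ hrK
  change HypTensor.spectralRadius (H.adjacencyTensor k) < r
  -- The maximum is attained, so the strict bound on each eigenvalue passes to the radius. With no
  -- eigenvalue at all the radius would be `sSup ∅ = 0`.
  by_cases hex : ∃ μ, HypTensor.IsEigenvalue (H.adjacencyTensor k) μ
  · obtain ⟨μ, hμ, heq⟩ := (HypTensor.isGreatest_spectralRadius _ hex).1
    rw [← heq]
    exact hlt μ hμ
  · have : {s : ℝ | ∃ μ, HypTensor.IsEigenvalue (H.adjacencyTensor k) μ ∧ ‖μ‖ = s} = ∅ := by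
      ext s
      simp only [Set.mem_ofPred_eq, Set.mem_empty_iff_false, iff_false]
      rintro ⟨μ, hμ, -⟩
      exact hex ⟨μ, hμ⟩
    rw [HypTensor.spectralRadius, this, Real.sSup_empty]
    exact hr

end Hypergraph

/-! ### The extremal theorem -/

theorem mainTheorem1 (k m : ℕ) (hk : 3 ≤ k) (hm : 5 < m) :
    (∃ v ∈ (Hypergraph.thetaPower k).vertexSet, (Hypergraph.thetaPower k).degree v = 3) ∧
    ∀ v ∈ (Hypergraph.thetaPower k).vertexSet, (Hypergraph.thetaPower k).degree v = 3 →
      (Hypergraph.thetaPowerWithStar k m v).IsPowerBicyclic k m ∧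
      ∀ {α : Type*} (H : Hypergraph α) [Finite H.vertexSet], H.IsPowerBicyclic k m →
        H.spectralRadius k ≤ (Hypergraph.thetaPowerWithStar k m v).spectralRadius k ∧
        (H.spectralRadius k = (Hypergraph.thetaPowerWithStar k m v).spectralRadius k ↔
          H.Isomorphic (Hypergraph.thetaPowerWithStar k m v)) := by
  refine ⟨⟨Sum.inl 0, Set.mem_univ _, by simp [Hypergraph.degree_thetaPower_inl]⟩, ?_⟩
  intro v _ hv
  obtain ⟨a, b, hab, rfl⟩ : ∃ a b : Fin 4, (a = 0 ∧ b = 1 ∨ a = 1 ∧ b = 0) ∧ v = Sum.inl a := by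
    rcases Hypergraph.eq_of_degree_thetaPower hv with rfl | rfl
    exacts [⟨0, 1, Or.inl ⟨rfl, rfl⟩, rfl⟩, ⟨1, 0, Or.inr ⟨rfl, rfl⟩, rfl⟩]
  have hiso : (Hypergraph.thetaPowerWithStar k m (Sum.inl a)).Isomorphic _ :=
    Hypergraph.coalescence_isomorphic_power (r := m - 5) k hab
  have hbook := Hypergraph.isBook_thetaStar (r := m - 5) hab
  have hedges := Hypergraph.card_edgeSet_thetaStar (r := m - 5) hab
  have hverts : Nat.card (Fin 4 ⊕ Fin (m - 5)) = m - 1 := by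
    rw [Nat.card_sum, Nat.card_fin, Nat.card_fin]
    omega
  constructor
  · have := Hypergraph.isPowerBicyclic_of_graph hk hiso ⟨_, _, hiso⟩ hbook.connected
      (by rw [hedges, hverts]; omega)
    rwa [hverts, show m - 1 + 1 = m by omega] at this
  · intro α H _ hH
    obtain ⟨W, G, hG⟩ := hH.power
    obtain ⟨hW, hc, hE, hm'⟩ := Hypergraph.graph_of_isPowerBicyclic hH hk hG
    by_cases hGb : G.IsBook
    · obtain ⟨φ⟩ := hGb.iso hbook (by rw [hverts]; omega)
      have hHG := hG.trans (Hypergraph.isomorphic_power_power φ)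
      have heq := Hypergraph.spectralRadius_eq_of_isomorphic_power hk hHG hiso
      exact ⟨heq.le, fun _ => hHG.trans hiso.symm, fun _ => heq⟩
    · have hlt := Hypergraph.spectralRadius_lt_of_isBook hk hG hiso hc (by omega) hGb hbook
        (by rw [hverts]; omega) (by omega)
      refine ⟨hlt.le, fun h => absurd h hlt.ne, fun h => ?_⟩
      exact Hypergraph.spectralRadius_eq_of_isomorphic_power hk (h.trans hiso) hiso
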